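/- **Theorem (continuous parabolic Wolff inequality).** Let $d\ge 2$, $n=d+2$, $1<q<\infty$, $q'=q/(q-1)$, and $\alpha>0$. For $t>0$ put $$\Gamma^{\alpha}(x,t)=\frac{t^{-(n-\alpha)/2}}{(4\pi)^{d/2}\,\Gamma(\alpha/2)}\,e^{-|x|^2/(4t)},\qquad \mathscr G_\alpha(x,t)=\frac{t^{-(n-\alpha)/2}}{(4\pi)^{d/2}\,\Gamma(\alpha/2)}\,e^{-t-|x|^2/(4t)}\qquad (x\in\mathbb R^d),$$ and let both kernels vanish for $t\le 0$. For a nonnegative Radon measure $\mu$ on $\mathbb R^{d+1}=\mathbb R^d\times\mathbb R$ and $w\in\mathbb R^{d+1}$ let $$\check\Gamma^{\alpha}\mu(w)=\int_{\mathbb R^{d+1}}\Gamma^\alpha(z-w)\,d\mu(z),\qquad \check{\mathscr G}_\alpha\mu(w)=\int_{\mathbb R^{d+1}}\mathscr G_\alpha(z-w)\,d\mu(z).$$ For $z=(x,t)$ and $r>0$ let $Q_r(z)=B_r(x)\times(t-r^2,t]$ be the time-backward parabolic ball, where $B_r(x)\subset\mathbb R^d$ is the open Euclidean ball, and let $$\dot{\mathbf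 W}_{\alpha,q}\mu(z)=\int_0^\infty\Big(\frac{\mu(Q_r(z))}{r^{n-\alpha q}}\Big)^{q'-1}\frac{dr}{r},\qquad \mathbf W_{\alpha,q}\mu(z)=\int_0^1\Big(\frac{\mu(Q_r(z))}{r^{n-\alpha q}}\Big)^{q'-1}\frac{dr}{r}.$$ (i) If $0<\alpha<n/q$, there is a constant $0<C<\infty$ depending only on $d,\alpha,q$ such that for every nonnegative Radon measure $\mu$ on $\mathbb R^{d+1}$ $$C^{-1}\int_{\mathbb R^{d+1}}\dot{\mathbf W}_{\alpha,q}\mu\,d\mu\ \le\ \int_{\mathbb R^{d+1}}|\check\Gamma^\alpha\mu|^{q'}\,dx\,dt\ \le\ C\int_{\mathbb R^{d+1}}\dot{\mathbf W}_{\alpha,q}\mu\,d\mu .$$ (ii) If $0<\alpha\le n/q$, there is a constant $0<C<\infty$ depending only on $d,\alpha,q$ such that for every nonnegative Radon measure $\mu$ on $\mathbb R^{d+1}$ $$C^{-1}\int_{\mathbb R^{d+1}}\mathbf W_{\alpha,q}\mu\,d\mu\ \le\ \int_{\mathbb R^{d+1}}|\check{\mathscr G}_\alpha\mu|^{q'}\,dx\,dt\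 \le\ C\int_{\mathbb R^{d+1}}\mathbf W_{\alpha,q}\mu\,d\mu .$$ All integrals take values in $[0,\infty]$, and the inequalities include the case where both sides are infinite. If moreover $\mu(\mathbb R^d\times\{t\})=0$ for every $t\in\mathbb R$, then (i) and (ii) also hold, with the same constants, when $Q_r(z)$ is replaced throughout by the open ball $B_r(x)\times(t-r^2,t)$. -/

import Mathlib

open MeasureTheory Set
open scoped ENNReal NNReal

namespace ParabolicWolff

/-- Space-time `ℝ^{d+1} = ℝ^d × ℝ`, points `z = (x, t)`. Its `volume` is the Lebesgue measure
`dx dt`, and distances between spatial components are Euclidean. -/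
abbrev SpaceTime (d : ℕ) : Type := EuclideanSpace ℝ (Fin d) × ℝ

/-- The homogeneous dimension `n = d + 2` of parabolic space-time. -/
def homDim (d : ℕ) : ℝ := (d : ℝ) + 2

/-- The parabolic Riesz kernel
`Γ^α(x,t) = [(4π)^{d/2} Γ(α/2)]⁻¹ t^{-(n-α)/2} exp(-|x|²/(4t)) 1_{t>0}`. -/
noncomputable def rieszKernel {d : ℕ} (α : ℝ) (z : SpaceTime d) : ℝ :=
  if 0 < z.2 then
    ((4 * Real.pi) ^ ((d : ℝ) / 2) * Real.Gamma (α / 2))⁻¹ *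
      z.2 ^ (-(homDim d - α) / 2) * Real.exp (-‖z.1‖ ^ 2 / (4 * z.2))
  else 0

/-- The parabolic Bessel kernel
`G_α(x,t) = [(4π)^{d/2} Γ(α/2)]⁻¹ t^{-(n-α)/2} exp(-t - |x|²/(4t)) 1_{t>0}`. -/
noncomputable def besselKernel {d : ℕ} (α : ℝ) (z : SpaceTime d) : ℝ :=
  if 0 < z.2 then
    ((4 * Real.pi) ^ ((d : ℝ) / 2) * Real.Gamma (α / 2))⁻¹ *
      z.2 ^ (-(homDim d - α) / 2) * Real.exp (-z.2 - ‖z.1‖ ^ 2 / (4 * z.2))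
  else 0

/-- The backward potential `(Ǩμ)(w) = ∫ K(z - w) dμ(z)` of a nonnegative kernel `K`, with values
in `[0, ∞]`. -/
noncomputable def backwardPotential {d : ℕ} (K : SpaceTime d → ℝ) (μ : Measure (SpaceTime d))
    (w : SpaceTime d) : ℝ≥0∞ :=
  ∫⁻ z, ENNReal.ofReal (K (z - w)) ∂μ

/-- The conjugate exponent `q' = q / (q - 1)`. -/
noncomputable def conjExp (q : ℝ) : ℝ := q / (q - 1)

/-- The homogeneous energy `∫ |Γ̌^α μ|^{q'} dx dt`. -/
noncomputable def rieszEnergy {d : ℕ} (α q : ℝ) (μ : Measure (SpaceTime d)) : ℝ≥0∞ :=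
  ∫⁻ w, backwardPotential (rieszKernel α) μ w ^ conjExp q

/-- The non-homogeneous energy `∫ |Ǧ_α μ|^{q'} dx dt`. -/
noncomputable def besselEnergy {d : ℕ} (α q : ℝ) (μ : Measure (SpaceTime d)) : ℝ≥0∞ :=
  ∫⁻ w, backwardPotential (besselKernel α) μ w ^ conjExp q

/-- The time-backward parabolic ball `B_r(x) × (t - r², t]`, which contains its centre `(x,t)`. -/
def backwardBall {d : ℕ} (z : SpaceTime d) (r : ℝ) : Set (SpaceTime d) :=
  Metric.ball z.1 r ×ˢ Ioc (z.2 - r ^ 2) z.2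

/-- The open time-backward parabolic ball `B_r(x) × (t - r², t)`. -/
def openBackwardBall {d : ℕ} (z : SpaceTime d) (r : ℝ) : Set (SpaceTime d) :=
  Metric.ball z.1 r ×ˢ Ioo (z.2 - r ^ 2) z.2

/-- The Wolff potential `∫_I (μ(Q_r(z)) / r^{n-αq})^{q'-1} dr/r` built from the family of balls
`Q z r = Q_r(z)` and a set `I` of radii. -/
noncomputable def wolffPotential {d : ℕ} (Q : SpaceTime d → ℝ → Set (SpaceTime d)) (I : Set ℝ)
    (α q : ℝ) (μ : Measure (SpaceTime d)) (z : SpaceTime d) : ℝ≥0∞ :=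
  ∫⁻ r in I, (μ (Q z r) / ENNReal.ofReal (r ^ (homDim d - α * q))) ^ (conjExp q - 1) /
    ENNReal.ofReal r

/-- The integral `∫ Ẇ_{α,q}μ dμ` of the homogeneous Wolff potential (all radii `0 < r < ∞`). -/
noncomputable def homWolffEnergy {d : ℕ} (Q : SpaceTime d → ℝ → Set (SpaceTime d))
    (α q : ℝ) (μ : Measure (SpaceTime d)) : ℝ≥0∞ :=
  ∫⁻ z, wolffPotential Q (Ioi 0) α q μ z ∂μ

/-- The integral `∫ W_{α,q}μ dμ` of the non-homogeneous Wolff potential (radii `0 < r < 1`). -/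
noncomputable def wolffEnergy {d : ℕ} (Q : SpaceTime d → ℝ → Set (SpaceTime d))
    (α q : ℝ) (μ : Measure (SpaceTime d)) : ℝ≥0∞ :=
  ∫⁻ z, wolffPotential Q (Ioo 0 1) α q μ z ∂μ

/-- Two-sided comparison `C⁻¹ b ≤ a ≤ C b` in `[0, ∞]`; in particular `a` and `b` are finite
together. -/
def ComparableWith (C : ℝ≥0) (a b : ℝ≥0∞) : Prop :=
  a ≤ C * b ∧ b ≤ C * a

/-- The measure gives no mass to any time slice `ℝ^d × {t}`. -/
def NoSliceMass {d : ℕ} (μ : Measure (SpaceTime d)) : Prop :=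
  ∀ t : ℝ, μ {z | z.2 = t} = 0

end ParabolicWolff

/-!
# The continuous parabolic Wolff inequality

Write `p = q'`, `n = d + 2`, `β = n - α`. Both sides of each inequality are compared with a discrete
energy. For a scale `s > 0`, space-time is tiled by the parabolic cells of spatial side `s` and
duration `s ^ 2`; `cellEnergy μ p s` is the sum of `μ(Q) ^ p` over the cells `Q`, and `dyadicEnergy`
is the sum of `s ^ (n - β p) * cellEnergy μ p s` over the scales `s = lam * 2 ^ k` with `k` in a set
`T ⊆ ℤ`: all of `ℤ` for the Riesz kernel, `k ≤ 0` for the Bessel kernel.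

* **Energy from below** (`dyadicEnergy_le_lintegral_backwardPotential`). The kernel is at least
  `c * s ^ (-β)` on the cell lying two time steps after the cell of the base point. For different
  dyadic scales these shifted cells are disjoint, so the potential dominates the sum of the
  contributions of all scales, and `∑ xₖ ^ p ≤ (∑ xₖ) ^ p`. The time shift disappears after
  integration in the base point.
* **Energy from above**. The kernels are at most a multiple of `ρ ^ (-β)`, where `ρ` is the
  parabolic distance, so the potential is bounded by the sum over the scales of
  `aₖ = s ^ (-β) * μ(3Q)`, with `3Q` the block of cells around the cell of the base point. What
  remains is `∫ (∑ aₖ) ^ p ≤ C ∑ ∫ aₖ ^ p` (`exists_lintegral_tsum_blockTerm_le`). It follows from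
  one property: against any weight that is constant on the cells of scale `k`, the sum of the `aⱼ`
  with `j ≤ k` integrates to at most a multiple of `aₖ`. For the Bessel kernel, the distances `ρ`
  that exceed the coarsest scale contribute a convolution with a summable exponential weight.
* **Wolff potentials**. A backward ball of radius `r ≤ s` lies in the block around the cell of its
  centre, which bounds the Wolff energy from above. In the other direction, a backward ball sees only
  the past of its centre, but within a cell the past is not negligible: for a finite measure
  `ν` on a cell, a quarter of the mass sits at points whose past has mass at least `ν(Q) / 4`
  (`lintegral_measure_le_rpow_ge`).

When `μ` charges no time slice, the balls with and without their top slice have equal measure, so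
both kinds of Wolff potentials coincide.
-/

namespace ParabolicWolff

/-! ### Sums whose partial sums average out -/

lemma add_rpow_le_rpow_add_mul {p : ℝ} (hp : 1 ≤ p) (x y : ℝ≥0∞) :
    (x + y) ^ p ≤ x ^ p + ENNReal.ofReal p * (y * (x + y) ^ (p - 1)) := by
  have hp0 : 0 < p := by linarith
  by_cases hx : x = ⊤
  · simp [hx, hp0]
  by_cases hy : y = ⊤
  · have h : (⊤ : ℝ≥0∞) ^ (p - 1) ≠ 0 := by
      simp [ENNReal.rpow_eq_zero_iff, hp]
    have h2 : ENNReal.ofReal p ≠ 0 := by simpa using hp0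
    simp only [hy, add_top]
    rw [ENNReal.top_mul h, ENNReal.mul_top h2]
    simp
  lift x to ℝ≥0 using hx
  lift y to ℝ≥0 using hy
  have hp1 : 0 ≤ p - 1 := by linarith
  rw [← ENNReal.coe_add, ← ENNReal.coe_rpow_of_nonneg _ hp0.le,
    ← ENNReal.coe_rpow_of_nonneg _ hp0.le, ← ENNReal.coe_rpow_of_nonneg _ hp1, ENNReal.ofReal]
  norm_cast
  rw [← NNReal.coe_le_coe]
  push_cast
  rw [Real.coe_toNNReal _ hp0.le]
  rcases eq_or_lt_of_le (zero_le : 0 ≤ x + y) with h0 | h0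
  · have hx0 : x = 0 := by
      have := (add_eq_zero.1 h0.symm).1; simpa using this
    have hy0 : y = 0 := by
      have := (add_eq_zero.1 h0.symm).2; simpa using this
    simp [hx0, hy0, hp0.ne']
  have hu : (0 : ℝ) < x + y := by exact_mod_cast h0
  have hb := one_add_mul_self_le_rpow_one_add (s := (x : ℝ) / (x + y) - 1)
    (by have : (0 : ℝ) ≤ (x : ℝ) / (x + y) := by positivity
        linarith) hp
  have h1 : (1 : ℝ) + ((x : ℝ) / (x + y) - 1) = x / (x + y) := by ring
  rw [h1, Real.div_rpow x.coe_nonneg hu.le, le_div_iff₀ (by positivity)] at hb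
  have h2 : ((x : ℝ) + y) ^ p = (x + y) * (x + y) ^ (p - 1) := by
    rw [← Real.rpow_one_add' hu.le (by linarith)]; congr 1; ring
  have h3 : (1 + p * ((x : ℝ) / (x + y) - 1)) * (x + y) ^ p
      = (x + y) ^ p - p * (y * (x + y) ^ (p - 1)) := by
    rw [h2]; field_simp; ring
  linarith

/-- A discrete form of `S ^ p = p ∫ S ^ (p - 1) dS`, obtained by telescoping along the order of `ι`. -/
lemma sum_rpow_le_partial_sums {ι : Type*} [LinearOrder ι] (I : Finset ι) (a : ι → ℝ≥0∞)
    {p : ℝ} (hp : 1 ≤ p) :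
    (∑ i ∈ I, a i) ^ p ≤
      ENNReal.ofReal p * ∑ i ∈ I, a i * (∑ j ∈ I with j ≤ i, a j) ^ (p - 1) := by
  induction I using Finset.induction_on_max with
  | empty => simp [show 0 < p by linarith]
  | insert m I hm ih =>
    have hmI : m ∉ I := fun h => lt_irrefl _ (hm m h)
    have h1 : ∀ i ∈ I, ({j ∈ insert m I | j ≤ i} : Finset ι) = {j ∈ I | j ≤ i} := by
      intro i hi
      rw [Finset.filter_insert, if_neg (not_le.2 (hm i hi))]
    have h3 : ∑ i ∈ I, a i * (∑ j ∈ insert m I with j ≤ i, a j) ^ (p - 1) =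
        ∑ i ∈ I, a i * (∑ j ∈ I with j ≤ i, a j) ^ (p - 1) :=
      Finset.sum_congr rfl fun i hi => by rw [h1 i hi]
    have h2 : ({j ∈ insert m I | j ≤ m} : Finset ι) = insert m I := by
      apply Finset.filter_true_of_mem
      intro i hi
      rcases Finset.mem_insert.1 hi with rfl | h
      · exact le_rfl
      · exact (hm i h).le
    rw [Finset.sum_insert hmI, Finset.sum_insert hmI, h2, Finset.sum_insert hmI, mul_add,
      h3, add_comm (a m)]
    exact (add_rpow_le_rpow_add_mul hp _ _).trans ((add_le_add_left ih _).trans_eq (add_comm _ _))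

lemma sum_rpow_le_tail_sums {ι : Type*} [LinearOrder ι] (I : Finset ι) (a : ι → ℝ≥0∞)
    {p : ℝ} (hp : 1 ≤ p) :
    (∑ i ∈ I, a i) ^ p ≤
      ENNReal.ofReal p * ∑ i ∈ I, a i * (∑ j ∈ I with i ≤ j, a j) ^ (p - 1) :=
  sum_rpow_le_partial_sums (ι := ιᵒᵈ) I a hp

lemma sum_rpow_le_rpow_sum {ι : Type*} (I : Finset ι) (a : ι → ℝ≥0∞) {p : ℝ} (hp : 1 ≤ p) :
    ∑ i ∈ I, a i ^ p ≤ (∑ i ∈ I, a i) ^ p := by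
  classical
  induction I using Finset.induction_on with
  | empty => simp
  | insert i I hi ih =>
    rw [Finset.sum_insert hi, Finset.sum_insert hi]
    exact (add_le_add le_rfl ih).trans (ENNReal.add_rpow_le_rpow_add _ _ hp)

lemma tsum_rpow_le_rpow_tsum {ι : Type*} (a : ι → ℝ≥0∞) {p : ℝ} (hp : 1 ≤ p) :
    ∑' i, a i ^ p ≤ (∑' i, a i) ^ p := by
  rw [ENNReal.tsum_eq_iSup_sum]
  refine iSup_le fun I => (sum_rpow_le_rpow_sum I a hp).trans ?_
  gcongr
  exact ENNReal.sum_le_tsum I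

/-- For `p ≤ 2` the exponent moves from `S` to the smaller `a`; this replaces Jensen's inequality for
the concave power `p - 1`. -/
lemma mul_rpow_le_rpow_mul {a S : ℝ≥0∞} (h : a ≤ S) {p : ℝ} (hp : 1 ≤ p)
    (hp2 : p ≤ 2) : a * S ^ (p - 1) ≤ a ^ (p - 1) * S := by
  have e1 : a = a ^ (p - 1) * a ^ (2 - p) := by
    rw [← ENNReal.rpow_add_of_nonneg _ _ (by linarith) (by linarith)]
    conv_lhs => rw [← ENNReal.rpow_one a]
    congr 1; ring
  have e2 : S = S ^ (2 - p) * S ^ (p - 1) := by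
    rw [← ENNReal.rpow_add_of_nonneg _ _ (by linarith) (by linarith)]
    conv_lhs => rw [← ENNReal.rpow_one S]
    congr 1; ring
  calc a * S ^ (p - 1) = a ^ (p - 1) * a ^ (2 - p) * S ^ (p - 1) := by rw [← e1]
    _ ≤ a ^ (p - 1) * S ^ (2 - p) * S ^ (p - 1) := by
      gcongr
    _ = a ^ (p - 1) * S := by rw [mul_assoc, ← e2]

section Core

variable {X κ ι : Type*} [MeasurableSpace X] {ν : Measure X} [LinearOrder ι]

/-- The case `1 < p ≤ 2` of `lintegral_sum_rpow_le`: bound `(∑ aᵢ) ^ p` by the sum of the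
`aᵢ * (∑_{j ≤ i} aⱼ) ^ (p - 1) ≤ aᵢ ^ (p - 1) * ∑_{j ≤ i} aⱼ` and use `aᵢ ^ (p - 1)` as the weight. -/
lemma lintegral_sum_rpow_le_of_le_two {I : Finset ι} {a : ι → X → ℝ≥0∞}
    (ha : ∀ i, Measurable (a i)) {π : ι → X → κ}
    (hπ : ∀ i, (a i).FactorsThrough (π i)) {C : ℝ≥0∞}
    (H : ∀ i ∈ I, ∀ F : X → ℝ≥0∞, F.FactorsThrough (π i) →
      ∫⁻ x, F x * ∑ j ∈ I with j ≤ i, a j x ∂ν ≤ C * ∫⁻ x, F x * a i x ∂ν)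
    {p : ℝ} (hp : 1 < p) (hp2 : p ≤ 2) :
    ∫⁻ x, (∑ i ∈ I, a i x) ^ p ∂ν ≤ ENNReal.ofReal p * C * ∑ i ∈ I, ∫⁻ x, a i x ^ p ∂ν := by
  have hpt : ∀ x, (∑ i ∈ I, a i x) ^ p ≤
      ENNReal.ofReal p * ∑ i ∈ I, a i x ^ (p - 1) * ∑ j ∈ I with j ≤ i, a j x := by
    intro x
    refine (sum_rpow_le_partial_sums I (fun i => a i x) hp.le).trans ?_
    refine mul_le_mul_right (Finset.sum_le_sum fun i hi => ?_) _
    refine mul_rpow_le_rpow_mul ?_ hp.le hp2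
    exact Finset.single_le_sum (f := fun j => a j x) (fun _ _ => zero_le)
        (Finset.mem_filter.2 ⟨hi, le_rfl⟩)
  refine (lintegral_mono hpt).trans ?_
  have hm : ∀ i ∈ I, Measurable fun x => a i x ^ (p - 1) * ∑ j ∈ I with j ≤ i, a j x :=
    fun i _ => ((ha i).pow_const _).mul (Finset.measurable_fun_sum _ fun j _ => ha j)
  rw [lintegral_const_mul _ (Finset.measurable_fun_sum _ hm), lintegral_finsetSum _ hm, mul_assoc,
    Finset.mul_sum (a := C)]
  refine mul_le_mul_right (Finset.sum_le_sum fun i hi => ?_) _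
  refine (H i hi _ fun x y hxy => by simp only [hπ i hxy]).trans ?_
  gcongr with x
  conv_lhs => rw [← ENNReal.rpow_one (a i x), ← ENNReal.rpow_mul, one_mul]
  rw [← ENNReal.rpow_add_of_nonneg _ _ (by linarith) zero_le_one, sub_add_cancel]

/-- For `p ≥ 2`, telescoping twice from the coarse end leaves a single factor that involves the finer
indices `j ≤ i`, and this factor occurs linearly. -/
lemma rpow_le_sum_partial_mul_tail (I : Finset ι) (a : ι → ℝ≥0∞) {p : ℝ} (hp : 2 ≤ p) :
    (∑ i ∈ I, a i) ^ p ≤ ENNReal.ofReal (p * (p - 1)) *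
      ∑ i ∈ I, (a i * (∑ j ∈ I with i ≤ j, a j) ^ (p - 2)) * ∑ j ∈ I with j ≤ i, a j := by
  refine (sum_rpow_le_tail_sums I a (by linarith)).trans ?_
  rw [ENNReal.ofReal_mul (by linarith), mul_assoc]
  gcongr
  have h1 : ∀ i ∈ I, a i * (∑ j ∈ I with i ≤ j, a j) ^ (p - 1) ≤
      ENNReal.ofReal (p - 1) * ∑ k ∈ I with i ≤ k,
        a i * (a k * (∑ j ∈ I with k ≤ j, a j) ^ (p - 2)) := by
    intro i _
    have := sum_rpow_le_tail_sums {j ∈ I | i ≤ j} a (p := p - 1) (by linarith)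
    rw [← Finset.mul_sum, mul_left_comm]
    gcongr
    refine this.trans ?_
    rw [show p - 1 - 1 = p - 2 by ring]
    refine mul_le_mul_right (Finset.sum_le_sum fun k _ => mul_le_mul_right
      (ENNReal.rpow_le_rpow (Finset.sum_le_sum_of_subset fun j hj => ?_) (by linarith)) _) _
    simp only [Finset.mem_filter] at hj ⊢
    exact ⟨hj.1.1, hj.2⟩
  refine (Finset.sum_le_sum h1).trans ?_
  rw [← Finset.mul_sum]
  refine mul_le_mul_right (le_of_eq ?_) _
  simp_rw [Finset.mul_sum, Finset.sum_filter (fun j => _ ≤ _) (fun j => _ * _)]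
  rw [Finset.sum_comm]
  refine Finset.sum_congr rfl fun k _ => Finset.sum_congr rfl fun i _ => ?_
  split_ifs with h
  · rw [mul_comm]
  · simp

/-- Absorption of a finite quantity `I` into the left-hand side. -/
lemma le_const_mul_of_absorb {I J K : ℝ≥0∞} {p : ℝ} (hp : 1 < p) (hI : I ≠ ⊤)
    (h : I ≤ K * (J ^ (1 / p) * I ^ (1 - 1 / p))) : I ≤ K ^ p * J := by
  have hp0 : 0 < p := by linarith
  by_cases h0 : I = 0
  · simp [h0]
  have e : I = I ^ (1 / p) * I ^ (1 - 1 / p) := by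
    rw [← ENNReal.rpow_add _ _ h0 hI]; simp
  have hpos : I ^ (1 - 1 / p) ≠ 0 := by
    simp [ENNReal.rpow_eq_zero_iff, h0, hI]
  have hne : I ^ (1 - 1 / p) ≠ ⊤ := by
    refine ENNReal.rpow_ne_top_of_nonneg ?_ hI
    rw [sub_nonneg, div_le_one hp0]; exact hp.le
  have h2 : I ^ (1 / p) ≤ K * J ^ (1 / p) := by
    rw [← mul_assoc] at h
    nth_rw 1 [e] at h
    exact (ENNReal.mul_le_mul_iff_left hpos hne).1 h
  calc I = (I ^ (1 / p)) ^ p := by rw [← ENNReal.rpow_mul]; field_simp; simp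
    _ ≤ (K * J ^ (1 / p)) ^ p := by gcongr
    _ = K ^ p * J := by
      rw [ENNReal.mul_rpow_of_nonneg _ _ hp0.le, ← ENNReal.rpow_mul]; field_simp; simp

/-- The case `p ≥ 2` of `lintegral_sum_rpow_le`. After `rpow_le_sum_partial_mul_tail` the weights are
`aᵢ * (∑_{j ≥ i} aⱼ) ^ (p - 2)`; the outcome `∑ aᵢ ^ 2 * (∑_{j ≥ i} aⱼ) ^ (p - 2)` is at most
`(∑ aᵢ ^ p) ^ (1 / p) * (∑ aᵢ) ^ (p - 1)`, and Hölder's inequality allows absorption. -/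
lemma lintegral_sum_rpow_le_of_two_le {I : Finset ι} {a : ι → X → ℝ≥0∞}
    (ha : ∀ i, Measurable (a i)) {π : ι → X → κ}
    (hπ : ∀ i, (a i).FactorsThrough (π i)) (hnest : ∀ i j, i ≤ j → (π j).FactorsThrough (π i))
    {C : ℝ≥0∞} (hC : C ≠ 0)
    (H : ∀ i ∈ I, ∀ F : X → ℝ≥0∞, F.FactorsThrough (π i) →
      ∫⁻ x, F x * ∑ j ∈ I with j ≤ i, a j x ∂ν ≤ C * ∫⁻ x, F x * a i x ∂ν)
    {p : ℝ} (hp : 2 ≤ p) :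
    ∫⁻ x, (∑ i ∈ I, a i x) ^ p ∂ν ≤
      (ENNReal.ofReal (p * (p - 1)) * C) ^ p * ∑ i ∈ I, ∫⁻ x, a i x ^ p ∂ν := by
  have hp0 : 0 < p := by linarith
  have hSm : Measurable fun x => ∑ i ∈ I, a i x := Finset.measurable_fun_sum _ fun j _ => ha j
  by_cases hJ : ∑ i ∈ I, ∫⁻ x, a i x ^ p ∂ν = ⊤
  · rw [hJ, ENNReal.mul_top]
    · exact le_top
    · have h1 : ENNReal.ofReal (p * (p - 1)) ≠ 0 := by
        rw [Ne, ENNReal.ofReal_eq_zero]; nlinarith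
      simp [ENNReal.rpow_eq_zero_iff, h1, hC, hp0.not_gt]
  -- Absorption needs the left-hand side to be finite, which holds since the sum is finite.
  have hIfin : ∫⁻ x, (∑ i ∈ I, a i x) ^ p ∂ν ≠ ⊤ := by
    have h1 : ∀ x, (∑ i ∈ I, a i x) ^ p ≤ (I.card : ℝ≥0∞) ^ (p - 1) * ∑ i ∈ I, a i x ^ p :=
      fun x => ENNReal.rpow_sum_le_const_mul_sum_rpow I (fun i => a i x) (by linarith)
    refine ne_top_of_le_ne_top ?_ (lintegral_mono h1)
    rw [lintegral_const_mul _ (Finset.measurable_fun_sum _ fun j _ => (ha j).pow_const _),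
      lintegral_finsetSum _ fun j _ => (ha j).pow_const _]
    refine ENNReal.mul_ne_top (ENNReal.rpow_ne_top_of_nonneg (by linarith) (by simp)) hJ
  refine le_const_mul_of_absorb (by linarith) hIfin ?_
  have hm : ∀ i ∈ I, Measurable fun x =>
      (a i x * (∑ j ∈ I with i ≤ j, a j x) ^ (p - 2)) * ∑ j ∈ I with j ≤ i, a j x := by
    intro i _
    exact ((ha i).mul ((Finset.measurable_fun_sum _ fun j _ => ha j).pow_const _)).mul
      (Finset.measurable_fun_sum _ fun j _ => ha j)
  have hm2 : ∀ i ∈ I, Measurable fun x =>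
      (a i x * (∑ j ∈ I with i ≤ j, a j x) ^ (p - 2)) * a i x := by
    intro i _
    exact ((ha i).mul ((Finset.measurable_fun_sum _ fun j _ => ha j).pow_const _)).mul (ha i)
  calc ∫⁻ x, (∑ i ∈ I, a i x) ^ p ∂ν
      ≤ ∫⁻ x, ENNReal.ofReal (p * (p - 1)) * ∑ i ∈ I,
          (a i x * (∑ j ∈ I with i ≤ j, a j x) ^ (p - 2)) * ∑ j ∈ I with j ≤ i, a j x ∂ν :=
        lintegral_mono fun x => rpow_le_sum_partial_mul_tail I (fun i => a i x) hp
    _ = ENNReal.ofReal (p * (p - 1)) * ∑ i ∈ I, ∫⁻ x,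
          (a i x * (∑ j ∈ I with i ≤ j, a j x) ^ (p - 2)) * ∑ j ∈ I with j ≤ i, a j x ∂ν := by
        rw [lintegral_const_mul _ (Finset.measurable_fun_sum _ hm), lintegral_finsetSum _ hm]
    _ ≤ ENNReal.ofReal (p * (p - 1)) * ∑ i ∈ I, C * ∫⁻ x,
          (a i x * (∑ j ∈ I with i ≤ j, a j x) ^ (p - 2)) * a i x ∂ν := by
        gcongr with i hi
        refine H i hi _ fun x y hxy => ?_
        have h2 : ∀ j ∈ {j ∈ I | i ≤ j}, a j x = a j y := fun j hj =>
          hπ j (hnest i j (Finset.mem_filter.1 hj).2 hxy)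
        simp only [hπ i hxy, Finset.sum_congr rfl h2]
    _ = ENNReal.ofReal (p * (p - 1)) * C * ∫⁻ x, ∑ i ∈ I,
          (a i x * (∑ j ∈ I with i ≤ j, a j x) ^ (p - 2)) * a i x ∂ν := by
        rw [lintegral_finsetSum _ hm2, ← Finset.mul_sum, mul_assoc]
    _ ≤ ENNReal.ofReal (p * (p - 1)) * C * ∫⁻ x, (∑ i ∈ I, a i x ^ p) ^ (1 / p) *
          (∑ i ∈ I, a i x) ^ (p - 1) ∂ν := by
        gcongr with x
        have h3 : ∀ i ∈ I, (a i x * (∑ j ∈ I with i ≤ j, a j x) ^ (p - 2)) * a i x ≤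
            ((∑ i ∈ I, a i x ^ p) ^ (1 / p) * (∑ i ∈ I, a i x) ^ (p - 2)) * a i x := by
          intro i hi
          refine mul_le_mul_left (mul_le_mul' ?_ (ENNReal.rpow_le_rpow
            (Finset.sum_le_sum_of_subset (Finset.filter_subset _ _)) (by linarith))) _
          · calc a i x = (a i x ^ p) ^ (1 / p) := by
                  rw [← ENNReal.rpow_mul]; field_simp; simp
              _ ≤ _ := by
                gcongr
                exact Finset.single_le_sum (f := fun i => a i x ^ p) (fun _ _ => zero_le) hi
        refine (Finset.sum_le_sum h3).trans ?_
        rw [← Finset.mul_sum, mul_assoc]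
        gcongr
        conv_lhs => rw [← ENNReal.rpow_one (∑ i ∈ I, a i x), ← ENNReal.rpow_mul, one_mul]
        rw [← ENNReal.rpow_add_of_nonneg _ _ (by linarith) zero_le_one]
        exact le_of_eq (by congr 1; ring)
    _ ≤ ENNReal.ofReal (p * (p - 1)) * C * ((∑ i ∈ I, ∫⁻ x, a i x ^ p ∂ν) ^ (1 / p) *
          (∫⁻ x, (∑ i ∈ I, a i x) ^ p ∂ν) ^ (1 - 1 / p)) := by
        gcongr
        have hpq : p.HolderConjugate (p / (p - 1)) :=
          Real.HolderConjugate.conjExponent (by linarith)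
        have := ENNReal.lintegral_mul_le_Lp_mul_Lq ν hpq
          (f := fun x => (∑ i ∈ I, a i x ^ p) ^ (1 / p))
          (g := fun x => (∑ i ∈ I, a i x) ^ (p - 1))
          ((Finset.measurable_fun_sum _ fun j _ => (ha j).pow_const _).pow_const _).aemeasurable
          (hSm.pow_const _).aemeasurable
        refine this.trans (le_of_eq ?_)
        have hne : p - 1 ≠ 0 := by linarith
        congr 1
        · congr 1
          rw [← lintegral_finsetSum _ fun j _ => (ha j).pow_const _]
          refine lintegral_congr fun x => ?_
          rw [← ENNReal.rpow_mul]; field_simp; simp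
        · have e1 : 1 / (p / (p - 1)) = 1 - 1 / p := by field_simp
          rw [e1]
          congr 1
          refine lintegral_congr fun x => ?_
          rw [← ENNReal.rpow_mul]; congr 1; field_simp

/-- Let the functions `aᵢ` be constant on the fibres of maps `πᵢ` that get coarser as `i` grows. If,
against every weight constant on the fibres of `πᵢ`, the sum of the `aⱼ` with `j ≤ i` integrates to
at most `C` times `aᵢ`, then `∫ (∑ aᵢ) ^ p` is controlled by `∑ ∫ aᵢ ^ p`, with a constant
independent of the number of terms. -/
lemma lintegral_sum_rpow_le {I : Finset ι} {a : ι → X → ℝ≥0∞}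
    (ha : ∀ i, Measurable (a i)) {π : ι → X → κ}
    (hπ : ∀ i, (a i).FactorsThrough (π i)) (hnest : ∀ i j, i ≤ j → (π j).FactorsThrough (π i))
    {C : ℝ≥0∞} (hC : C ≠ 0)
    (H : ∀ i ∈ I, ∀ F : X → ℝ≥0∞, F.FactorsThrough (π i) →
      ∫⁻ x, F x * ∑ j ∈ I with j ≤ i, a j x ∂ν ≤ C * ∫⁻ x, F x * a i x ∂ν)
    {p : ℝ} (hp : 1 < p) :
    ∫⁻ x, (∑ i ∈ I, a i x) ^ p ∂ν ≤
      (ENNReal.ofReal p * C + (ENNReal.ofReal (p * (p - 1)) * C) ^ p) *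
        ∑ i ∈ I, ∫⁻ x, a i x ^ p ∂ν := by
  rcases le_total p 2 with h | h
  · exact (lintegral_sum_rpow_le_of_le_two ha hπ H hp h).trans (by gcongr; exact le_self_add)
  · exact (lintegral_sum_rpow_le_of_two_le ha hπ hnest hC H h).trans
      (by gcongr; exact le_add_self)

end Core

/-! ### Parabolic cells -/

variable {d : ℕ}

/-- Indices of the parabolic cells of a given scale: one integer per space coordinate, and one for
time. -/
abbrev CellIndex (d : ℕ) : Type := (Fin d → ℤ) × ℤ

/-- The index of the half-open parabolic cell of spatial side `s` and duration `s ^ 2` that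
contains `z`. -/
noncomputable def cell (s : ℝ) (z : SpaceTime d) : CellIndex d :=
  (fun i => ⌊z.1 i / s⌋, ⌊z.2 / s ^ 2⌋)

/-- The mass that `μ` gives to the cell of scale `s` with index `c`. -/
noncomputable def cellMass (μ : Measure (SpaceTime d)) (s : ℝ) (c : CellIndex d) : ℝ≥0∞ :=
  μ (cell s ⁻¹' {c})

/-- The `3 ^ (d + 1)` index differences between a cell and the cells that touch it, itself included. -/
noncomputable def unitBlock (d : ℕ) : Finset (CellIndex d) :=
  Finset.Icc (-1) 1 ×ˢ Finset.Icc (-1) 1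

/-- The mass of the block formed by the cell `c` and all the cells touching it. -/
noncomputable def blockMass (μ : Measure (SpaceTime d)) (s : ℝ) (c : CellIndex d) : ℝ≥0∞ :=
  μ {z | cell s z - c ∈ unitBlock d}

/-- The Lebesgue measure of a parabolic cell of scale `s`. -/
noncomputable def cellVolume (d : ℕ) (s : ℝ) : ℝ≥0∞ := ENNReal.ofReal (s ^ homDim d)

lemma measurable_cell (s : ℝ) : Measurable (cell s : SpaceTime d → CellIndex d) := by
  unfold cell
  refine Measurable.prodMk (measurable_pi_lambda _ fun i => ?_) ?_
  · refine Int.measurable_floor.comp (Measurable.div_const ?_ _)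
    fun_prop
  · exact Int.measurable_floor.comp (by fun_prop)

lemma lintegral_comp_cell (μ : Measure (SpaceTime d)) (s : ℝ) (F : CellIndex d → ℝ≥0∞) :
    ∫⁻ z, F (cell s z) ∂μ = ∑' c, F c * cellMass μ s c := by
  rw [← lintegral_map (f := F) (measurable_of_countable F) (measurable_cell s),
    lintegral_countable']
  refine tsum_congr fun c => ?_
  rw [Measure.map_apply (measurable_cell s) (measurableSet_singleton c), cellMass]

lemma cellMass_volume {s : ℝ} (hs : 0 < s) (c : CellIndex d) :
    cellMass volume s c = cellVolume d s := by
  have h1 : (cell s ⁻¹' {c} : Set (SpaceTime d)) =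
      ((WithLp.ofLp : EuclideanSpace ℝ (Fin d) → Fin d → ℝ) ⁻¹'
        (univ.pi fun i => Ico (c.1 i * s) ((c.1 i + 1) * s))) ×ˢ
          Ico (c.2 * s ^ 2) ((c.2 + 1) * s ^ 2) := by
    ext z
    simp only [mem_preimage, mem_singleton_iff, cell, Prod.ext_iff, funext_iff, Int.floor_eq_iff,
      mem_prod, mem_pi, mem_univ, true_implies, mem_Ico, le_div_iff₀ hs,
      div_lt_iff₀ hs, le_div_iff₀ (pow_pos hs 2), div_lt_iff₀ (pow_pos hs 2)]
  rw [cellMass, h1, Measure.volume_eq_prod, Measure.prod_prod,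
    (PiLp.volume_preserving_ofLp (Fin d)).measure_preimage
      (MeasurableSet.univ_pi fun i => measurableSet_Ico).nullMeasurableSet, volume_pi_pi]
  simp only [Real.volume_Ico, ← sub_mul, add_sub_cancel_left, one_mul, Finset.prod_const,
    Finset.card_univ, Fintype.card_fin]
  rw [← ENNReal.ofReal_pow hs.le, ← ENNReal.ofReal_mul (by positivity), ← pow_add, cellVolume,
    homDim]
  congr 1
  exact_mod_cast (Real.rpow_natCast s (d + 2)).symm

lemma lintegral_comp_cell_volume {s : ℝ} (hs : 0 < s) (F : CellIndex d → ℝ≥0∞) :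
    ∫⁻ z : SpaceTime d, F (cell s z) = cellVolume d s * ∑' c, F c := by
  rw [lintegral_comp_cell, ← ENNReal.tsum_mul_left]
  exact tsum_congr fun c => by rw [cellMass_volume hs, mul_comm]

lemma mem_unitBlock {e : CellIndex d} :
    e ∈ unitBlock d ↔ (∀ i, -1 ≤ e.1 i ∧ e.1 i ≤ 1) ∧ (-1 ≤ e.2 ∧ e.2 ≤ 1) := by
  simp only [unitBlock, Finset.mem_product, Finset.mem_Icc, Pi.le_def, Pi.neg_apply, Pi.one_apply,
    forall_and]

lemma neg_mem_unitBlock {e : CellIndex d} : -e ∈ unitBlock d ↔ e ∈ unitBlock d := by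
  simp only [mem_unitBlock, Prod.fst_neg, Pi.neg_apply, Prod.snd_neg, neg_le_neg_iff, neg_le (b := (1 : ℤ))]
  simp only [neg_le_iff_add_nonneg, and_comm]

lemma zero_mem_unitBlock : (0 : CellIndex d) ∈ unitBlock d := by
  simp [mem_unitBlock]

lemma blockMass_eq_sum (μ : Measure (SpaceTime d)) (s : ℝ) (c : CellIndex d) :
    blockMass μ s c = ∑ e ∈ unitBlock d, cellMass μ s (c + e) := by
  have h : {z | cell s z - c ∈ unitBlock d} =
      ⋃ e ∈ unitBlock d, cell s ⁻¹' {c + e} := by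
    ext z
    simp only [mem_ofPred_eq, mem_iUnion, mem_preimage, mem_singleton_iff, exists_prop]
    constructor
    · intro h; exact ⟨_, h, by abel⟩
    · rintro ⟨e, he, h⟩; rw [h]; simpa using he
  rw [blockMass, h, measure_biUnion_finset]
  · rfl
  · intro e _ e' _ hee
    refine Disjoint.preimage _ ?_
    simpa using hee
  · exact fun e _ => measurable_cell s (measurableSet_singleton _)

lemma cellMass_le_blockMass (μ : Measure (SpaceTime d)) (s : ℝ) (c : CellIndex d) :
    cellMass μ s c ≤ blockMass μ s c := by
  refine measure_mono fun z hz => ?_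
  rw [mem_preimage, mem_singleton_iff] at hz
  simp [hz, zero_mem_unitBlock]

lemma floor_div_mul_natCast (x s : ℝ) (n : ℕ) : ⌊x / (s * n)⌋ = ⌊x / s⌋ / n := by
  rw [← div_div, Int.floor_div_natCast]

lemma cell_mul_two_pow (s : ℝ) (m : ℕ) (z : SpaceTime d) :
    cell (s * 2 ^ m) z =
      (fun i => (cell s z).1 i / ((2 ^ m : ℕ) : ℤ), (cell s z).2 / ((4 ^ m : ℕ) : ℤ)) := by
  have h : (s * 2 ^ m) ^ 2 = s ^ 2 * ((4 ^ m : ℕ) : ℝ) := by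
    push_cast; rw [mul_pow, ← pow_mul, mul_comm m 2, pow_mul]; norm_num
  have h2 : s * 2 ^ m = s * ((2 ^ m : ℕ) : ℝ) := by push_cast; rfl
  simp only [cell]
  rw [h, floor_div_mul_natCast, h2]
  simp only [floor_div_mul_natCast]

lemma ediv_sub_ediv_mem {a b : ℤ} {n : ℕ} (hn : 0 < n) (h : -1 ≤ a - b ∧ a - b ≤ 1) :
    -1 ≤ a / (n : ℤ) - b / (n : ℤ) ∧ a / (n : ℤ) - b / (n : ℤ) ≤ 1 := by
  have hn' : (0 : ℤ) < n := by exact_mod_cast hn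
  have h1 : a / (n : ℤ) ≤ (b + 1 * n) / (n : ℤ) := Int.ediv_le_ediv hn' (by linarith)
  have h2 : b / (n : ℤ) ≤ (a + 1 * n) / (n : ℤ) := Int.ediv_le_ediv hn' (by linarith)
  rw [Int.add_mul_ediv_right _ _ hn'.ne'] at h1 h2
  constructor <;> linarith

/-- Points in touching cells lie in touching cells of every coarser dyadic scale. -/
lemma sub_mem_unitBlock_of_finer (s : ℝ) (m : ℕ) {z w : SpaceTime d}
    (h : cell s z - cell s w ∈ unitBlock d) :
    cell (s * 2 ^ m) z - cell (s * 2 ^ m) w ∈ unitBlock d := by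
  rw [mem_unitBlock] at h ⊢
  simp only [cell_mul_two_pow]
  exact ⟨fun i => ediv_sub_ediv_mem (by positivity) (h.1 i),
    ediv_sub_ediv_mem (by positivity) h.2⟩

lemma tsum_mul_blockMass (μ : Measure (SpaceTime d)) (s : ℝ) (F : CellIndex d → ℝ≥0∞) :
    ∑' c, F c * blockMass μ s c = ∫⁻ z, ∑ e ∈ unitBlock d, F (cell s z + e) ∂μ := by
  rw [lintegral_comp_cell μ s fun c => ∑ e ∈ unitBlock d, F (c + e)]
  simp only [blockMass_eq_sum, Finset.mul_sum, Finset.sum_mul]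
  rw [Summable.tsum_finsetSum fun _ _ => ENNReal.summable,
    Summable.tsum_finsetSum fun _ _ => ENNReal.summable]
  refine Finset.sum_bij' (fun e _ => -e) (fun e _ => -e) (fun e => neg_mem_unitBlock.2)
    (fun e => neg_mem_unitBlock.2) (by simp) (by simp) fun e _ => ?_
  rw [← (Equiv.addRight (-e)).tsum_eq]
  simp

/-- The averaging property of block masses: by Tonelli's theorem, the fine block masses are traded for
the volume of a fine block, while the coarse weight `F` is carried over to the neighbouring coarse
cells. -/
lemma lintegral_mul_blockMass_le (μ : Measure (SpaceTime d)) [SFinite μ] {s : ℝ} (hs : 0 < s)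
    (m : ℕ) (F : CellIndex d → ℝ≥0∞) :
    ∫⁻ w, F (cell (s * 2 ^ m) w) * blockMass μ s (cell s w) ≤
      (unitBlock d).card * cellVolume d s * ∑' c, F c * blockMass μ (s * 2 ^ m) c := by
  have hF : Measurable fun w : SpaceTime d => F (cell (s * 2 ^ m) w) :=
    (measurable_of_countable F).comp (measurable_cell _)
  have hS : MeasurableSet {x : SpaceTime d × SpaceTime d |
      cell s x.2 - cell s x.1 ∈ unitBlock d} :=
    (((measurable_cell s).comp measurable_snd).sub ((measurable_cell s).comp measurable_fst))
      (Finset.measurableSet _)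
  set S := {x : SpaceTime d × SpaceTime d | cell s x.2 - cell s x.1 ∈ unitBlock d} with hSdef
  have hSw : ∀ w, MeasurableSet {z | cell s z - cell s w ∈ unitBlock d} := fun w =>
    measurable_prodMk_left hS
  calc ∫⁻ w, F (cell (s * 2 ^ m) w) * blockMass μ s (cell s w)
      = ∫⁻ w, ∫⁻ z, F (cell (s * 2 ^ m) w) * S.indicator 1 (w, z) ∂μ := by
        refine lintegral_congr fun w => ?_
        have h1 : Measurable fun z => S.indicator (1 : SpaceTime d × SpaceTime d → ℝ≥0∞) (w, z) :=
          (measurable_one.indicator hS).comp measurable_prodMk_left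
        rw [lintegral_const_mul _ h1, blockMass, ← lintegral_indicator_one (hSw w)]
        rfl
    _ = ∫⁻ z, (∫⁻ w, F (cell (s * 2 ^ m) w) * S.indicator 1 (w, z)) ∂μ := by
        refine lintegral_lintegral_swap (Measurable.aemeasurable ?_)
        exact (hF.comp measurable_fst).mul (measurable_one.indicator hS)
    _ ≤ ∫⁻ z, (∫⁻ w, (∑ e ∈ unitBlock d, F (cell (s * 2 ^ m) z + e)) *
          S.indicator 1 (w, z)) ∂μ := by
        refine lintegral_mono fun z => lintegral_mono fun w => ?_
        by_cases h : (w, z) ∈ S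
        · refine mul_le_mul_left ?_ _
          have h2 : cell (s * 2 ^ m) w - cell (s * 2 ^ m) z ∈ unitBlock d := by
            rw [← neg_mem_unitBlock, neg_sub]
            exact sub_mem_unitBlock_of_finer s m h
          have := Finset.single_le_sum (f := fun e => F (cell (s * 2 ^ m) z + e))
            (fun _ _ => zero_le) h2
          simpa using this
        · simp [h]
    _ = ∫⁻ z, (unitBlock d).card * cellVolume d s *
          ∑ e ∈ unitBlock d, F (cell (s * 2 ^ m) z + e) ∂μ := by
        refine lintegral_congr fun z => ?_
        have h0 : Measurable fun w => S.indicator (1 : SpaceTime d × SpaceTime d → ℝ≥0∞) (w, z) :=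
          (measurable_one.indicator hS).comp measurable_prodMk_right
        rw [lintegral_const_mul _ h0, mul_comm]
        congr 1
        have h1 : ∀ w, S.indicator (1 : SpaceTime d × SpaceTime d → ℝ≥0∞) (w, z) =
            {w | cell s w - cell s z ∈ unitBlock d}.indicator 1 w := by
          intro w
          have h2 : (w, z) ∈ S ↔ w ∈ {w | cell s w - cell s z ∈ unitBlock d} := by
            rw [mem_ofPred_eq, ← neg_mem_unitBlock, neg_sub]
            rfl
          by_cases h : (w, z) ∈ S
          · rw [indicator_of_mem h, indicator_of_mem (h2.1 h)]; rfl
          · rw [indicator_of_notMem h, indicator_of_notMem (fun h' => h (h2.2 h'))]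
        simp_rw [h1]
        rw [lintegral_indicator_one (hSw z)]
        change blockMass volume s (cell s z) = _
        simp [blockMass_eq_sum, cellMass_volume hs]
    _ = _ := by
        rw [tsum_mul_blockMass, lintegral_const_mul]
        exact (measurable_of_countable fun c : CellIndex d =>
          ∑ e ∈ unitBlock d, F (c + e)).comp (measurable_cell _)

/-- Jensen's inequality for a weighted sum whose weights need not have total mass one. -/
lemma tsum_mul_rpow_le {ι : Type*} (ω a : ι → ℝ≥0∞) {p : ℝ} (hp : 1 < p) :
    (∑' i, ω i * a i) ^ p ≤ (∑' i, ω i) ^ (p - 1) * ∑' i, ω i * a i ^ p := by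
  let _ : MeasurableSpace ι := ⊤
  have hpq : p.HolderConjugate (p / (p - 1)) := Real.HolderConjugate.conjExponent hp
  have h := ENNReal.lintegral_mul_le_Lp_mul_Lq Measure.count hpq
    (f := fun i => ω i ^ (1 / p) * a i) (g := fun i => ω i ^ (1 - 1 / p))
    measurable_from_top.aemeasurable measurable_from_top.aemeasurable
  simp only [lintegral_count, Pi.mul_apply] at h
  have hp0 : p ≠ 0 := by linarith
  have hp1 : p - 1 ≠ 0 := by linarith
  have h0 : 0 ≤ 1 - 1 / p := by rw [sub_nonneg, div_le_one (by linarith)]; exact hp.le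
  have e1 : ∀ i, ω i ^ (1 / p) * a i * ω i ^ (1 - 1 / p) = ω i * a i := by
    intro i
    rw [mul_right_comm, ← ENNReal.rpow_add_of_nonneg _ _ (by positivity) h0]
    simp
  have e2 : ∀ i, (ω i ^ (1 / p) * a i) ^ p = ω i * a i ^ p := by
    intro i
    rw [ENNReal.mul_rpow_of_nonneg _ _ (by linarith), ← ENNReal.rpow_mul]
    field_simp; simp
  have e3 : ∀ i, (ω i ^ (1 - 1 / p)) ^ (p / (p - 1)) = ω i := by
    intro i
    rw [← ENNReal.rpow_mul, show (1 - 1 / p) * (p / (p - 1)) = 1 by field_simp]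
    simp
  simp only [e1, e2, e3] at h
  calc (∑' i, ω i * a i) ^ p ≤ _ := ENNReal.rpow_le_rpow h (by linarith)
    _ = _ := by
      rw [ENNReal.mul_rpow_of_nonneg _ _ (by linarith), ← ENNReal.rpow_mul, ← ENNReal.rpow_mul,
        show 1 / p * p = 1 by field_simp, show 1 / (p / (p - 1)) * p = p - 1 by field_simp,
        ENNReal.rpow_one, mul_comm]

/-- Young's inequality `‖ω * a‖_p ≤ ‖ω‖_1 ‖a‖_p` on a discrete group. -/
lemma tsum_convolution_rpow_le {G : Type*} [AddCommGroup G] (ω a : G → ℝ≥0∞) {p : ℝ}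
    (hp : 1 < p) :
    ∑' c, (∑' e, ω e * a (c + e)) ^ p ≤ (∑' e, ω e) ^ p * ∑' c, a c ^ p := by
  calc ∑' c, (∑' e, ω e * a (c + e)) ^ p
      ≤ ∑' c, (∑' e, ω e) ^ (p - 1) * ∑' e, ω e * a (c + e) ^ p :=
        ENNReal.tsum_le_tsum fun c => tsum_mul_rpow_le _ _ hp
    _ = (∑' e, ω e) ^ (p - 1) * ∑' e, ω e * ∑' c, a c ^ p := by
        rw [ENNReal.tsum_mul_left, ENNReal.tsum_comm]
        congr 1
        refine tsum_congr fun e => ?_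
        rw [ENNReal.tsum_mul_left, ← (Equiv.addRight e).tsum_eq fun c => a c ^ p]
        rfl
    _ = (∑' e, ω e) ^ p * ∑' c, a c ^ p := by
        rw [ENNReal.tsum_mul_right, ← mul_assoc]
        congr 1
        conv_lhs => rw [← ENNReal.rpow_one (∑' e, ω e), ← ENNReal.rpow_mul, one_mul]
        rw [← ENNReal.rpow_add_of_nonneg _ _ (by linarith) zero_le_one, sub_add_cancel]

/-- The `p`-energy of `μ` at scale `s`: the sum of `μ(Q) ^ p` over the parabolic cells of scale `s`. -/
noncomputable def cellEnergy (μ : Measure (SpaceTime d)) (p s : ℝ) : ℝ≥0∞ :=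
  ∑' c, cellMass μ s c ^ p

lemma tsum_blockMass_rpow_le (μ : Measure (SpaceTime d)) (s : ℝ) {p : ℝ} (hp : 1 < p) :
    ∑' c, blockMass μ s c ^ p ≤ ((unitBlock d).card : ℝ≥0∞) ^ p * cellEnergy μ p s := by
  have h := tsum_convolution_rpow_le ((unitBlock d : Set (CellIndex d)).indicator 1)
    (cellMass μ s) hp
  have h1 : ∀ c, ∑' e, (unitBlock d : Set (CellIndex d)).indicator 1 e * cellMass μ s (c + e) =
      blockMass μ s c := by
    intro c
    rw [blockMass_eq_sum, tsum_eq_sum (s := unitBlock d)]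
    · exact Finset.sum_congr rfl fun e he => by simp [he]
    · intro e he; simp [he]
  have h2 : ∑' e, (unitBlock d : Set (CellIndex d)).indicator (1 : CellIndex d → ℝ≥0∞) e =
      (unitBlock d).card := by
    rw [tsum_eq_sum (s := unitBlock d)]
    · rw [Finset.sum_congr rfl (g := fun _ => 1) fun e he => by simp [he]]; simp
    · intro e he; simp [he]
  simpa only [h1, h2, cellEnergy] using h

/-! ### The dyadic Wolff inequality -/

lemma ofReal_rpow_mul_ofReal_rpow {x : ℝ} (hx : 0 < x) (a b : ℝ) :
    ENNReal.ofReal (x ^ a) * ENNReal.ofReal (x ^ b) = ENNReal.ofReal (x ^ (a + b)) := by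
  rw [← ENNReal.ofReal_mul (by positivity), Real.rpow_add hx]

lemma ofReal_rpow_rpow {x : ℝ} (hx : 0 < x) (a p : ℝ) :
    ENNReal.ofReal (x ^ a) ^ p = ENNReal.ofReal (x ^ (a * p)) := by
  rw [ENNReal.ofReal_rpow_of_pos (by positivity), Real.rpow_mul hx.le]

/-- The scale `lam * 2 ^ k`; the ratio `lam` leaves room to place the coarsest scale. -/
noncomputable def dyadicScale (lam : ℝ) (k : ℤ) : ℝ := lam * 2 ^ k

lemma dyadicScale_pos {lam : ℝ} (h : 0 < lam) (k : ℤ) : 0 < dyadicScale lam k := by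
  unfold dyadicScale; positivity

lemma dyadicScale_add_nat (lam : ℝ) (k : ℤ) (m : ℕ) :
    dyadicScale lam (k + m) = dyadicScale lam k * 2 ^ m := by
  unfold dyadicScale
  rw [zpow_add₀ (by norm_num), mul_assoc, zpow_natCast]

lemma dyadicScale_of_le (lam : ℝ) {j k : ℤ} (h : j ≤ k) :
    dyadicScale lam k = dyadicScale lam j * 2 ^ (k - j).toNat := by
  rw [← dyadicScale_add_nat, Int.toNat_of_nonneg (by omega)]
  congr 1; ring

/-- The contribution of scale `s` to a potential with kernel of homogeneity `-β`. -/
noncomputable def blockTerm (μ : Measure (SpaceTime d)) (β s : ℝ) (w : SpaceTime d) : ℝ≥0∞ :=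
  ENNReal.ofReal (s ^ (-β)) * blockMass μ s (cell s w)

lemma blockTerm_factorsThrough (μ : Measure (SpaceTime d)) (β s : ℝ) :
    (blockTerm μ β s).FactorsThrough (cell s) := fun x y h => by
  simp only [blockTerm, h]

lemma measurable_blockTerm (μ : Measure (SpaceTime d)) (β s : ℝ) :
    Measurable (blockTerm μ β s) :=
  ((measurable_of_countable (blockMass μ s)).comp (measurable_cell s)).const_mul _

lemma cell_factorsThrough (s : ℝ) (m : ℕ) :
    (cell (s * 2 ^ m) : SpaceTime d → CellIndex d).FactorsThrough (cell s) := fun x y h => by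
  simp only [cell_mul_two_pow, h]

lemma lintegral_blockTerm_rpow {s : ℝ} (hs : 0 < s) (μ : Measure (SpaceTime d)) (β : ℝ) {p : ℝ}
    (hp : 0 ≤ p) :
    ∫⁻ w, blockTerm μ β s w ^ p =
      ENNReal.ofReal (s ^ (homDim d - β * p)) * ∑' c, blockMass μ s c ^ p := by
  simp only [blockTerm, ENNReal.mul_rpow_of_nonneg _ _ hp]
  rw [lintegral_comp_cell_volume hs fun c => ENNReal.ofReal (s ^ (-β)) ^ p * blockMass μ s c ^ p,
    ENNReal.tsum_mul_left, ← mul_assoc, ofReal_rpow_rpow hs, cellVolume,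
    ofReal_rpow_mul_ofReal_rpow hs]
  congr 4; ring

/-- The fine contribution is smaller than the coarse one by the factor `2 ^ (-α m)`, when both are
integrated against a weight constant on the coarse cells. -/
lemma lintegral_mul_blockTerm_le (μ : Measure (SpaceTime d)) [SFinite μ] {s α β : ℝ} (hs : 0 < s)
    (hαβ : α + β = homDim d) (m : ℕ) {F : SpaceTime d → ℝ≥0∞}
    (hF : F.FactorsThrough (cell (s * 2 ^ m))) :
    ∫⁻ w, F w * blockTerm μ β s w ≤ (unitBlock d).card * ENNReal.ofReal (2 ^ (-α)) ^ m *
      ∫⁻ w, F w * blockTerm μ β (s * 2 ^ m) w := by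
  obtain ⟨G, rfl⟩ := (Function.factorsThrough_iff F).1 hF
  set σ := s * 2 ^ m with hσ
  have hσ0 : 0 < σ := by positivity
  have hG : Measurable (G ∘ cell σ) := (measurable_of_countable G).comp (measurable_cell _)
  have hM : Measurable fun w : SpaceTime d => blockMass μ s (cell s w) :=
    (measurable_of_countable (blockMass μ s)).comp (measurable_cell s)
  have e1 : ∫⁻ w, (G ∘ cell σ) w * blockTerm μ β s w = ENNReal.ofReal (s ^ (-β)) *
      ∫⁻ w, G (cell σ w) * blockMass μ s (cell s w) := by
    have hGM : Measurable fun w => G (cell σ w) * blockMass μ s (cell s w) := hG.mul hM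
    rw [← lintegral_const_mul _ hGM]
    exact lintegral_congr fun w => by simp only [blockTerm, Function.comp]; ring
  have e2 : ∫⁻ w, (G ∘ cell σ) w * blockTerm μ β σ w = ENNReal.ofReal (σ ^ α) *
      ∑' c, G c * blockMass μ σ c := by
    simp only [blockTerm, Function.comp]
    rw [lintegral_comp_cell_volume hσ0
      fun c => G c * (ENNReal.ofReal (σ ^ (-β)) * blockMass μ σ c)]
    simp_rw [mul_left_comm (G _)]
    rw [ENNReal.tsum_mul_left, ← mul_assoc, cellVolume, ofReal_rpow_mul_ofReal_rpow hσ0]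
    congr 4; linarith
  have e3 : ENNReal.ofReal (s ^ (-β)) * cellVolume d s =
      ENNReal.ofReal (2 ^ (-α)) ^ m * ENNReal.ofReal (σ ^ α) := by
    rw [cellVolume, ofReal_rpow_mul_ofReal_rpow hs, ← ENNReal.ofReal_pow (by positivity),
      ← ENNReal.ofReal_mul (by positivity)]
    congr 1
    rw [hσ, Real.mul_rpow hs.le (by positivity), ← Real.rpow_natCast, ← Real.rpow_natCast,
      ← Real.rpow_mul (by norm_num), ← Real.rpow_mul (by norm_num), mul_left_comm,
      ← Real.rpow_add (by norm_num)]
    rw [show -α * m + m * α = 0 by ring, Real.rpow_zero, mul_one]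
    congr 1; linarith
  rw [e1, e2]
  calc _ ≤ ENNReal.ofReal (s ^ (-β)) * ((unitBlock d).card * cellVolume d s *
        ∑' c, G c * blockMass μ σ c) := by
        gcongr
        exact lintegral_mul_blockMass_le μ hs m G
    _ = (unitBlock d).card * (ENNReal.ofReal (s ^ (-β)) * cellVolume d s) *
        ∑' c, G c * blockMass μ σ c := by ring
    _ = _ := by rw [e3]; ring

lemma sum_geometric_le {T : Set ℤ} (I : Finset T) (k : T) (r : ℝ≥0∞) :
    ∑ j ∈ I with j ≤ k, r ^ ((k : ℤ) - j).toNat ≤ (1 - r)⁻¹ := by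
  rw [← ENNReal.tsum_geometric]
  have hinj : Set.InjOn (fun j : T => ((k : ℤ) - j).toNat) ({j ∈ I | j ≤ k} : Finset T) := by
    intro i hi j hj hij
    simp only [Finset.coe_filter, mem_ofPred_eq, ← Subtype.coe_le_coe] at hi hj
    simp only at hij
    ext; omega
  rw [← Finset.sum_image (f := fun m : ℕ => r ^ m) hinj]
  exact ENNReal.sum_le_tsum _

lemma ofReal_two_rpow_neg_lt_one {α : ℝ} (hα : 0 < α) : ENNReal.ofReal (2 ^ (-α)) < 1 := by
  rw [ENNReal.ofReal_lt_one]
  exact Real.rpow_lt_one_of_one_lt_of_neg (by norm_num) (by linarith)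

/-- The discrete Wolff energy: the weighted sum of the cell energies over the scales `lam * 2 ^ k`,
`k ∈ T`. -/
noncomputable def dyadicEnergy (μ : Measure (SpaceTime d)) (β p lam : ℝ) (T : Set ℤ) : ℝ≥0∞ :=
  ∑' k : T, ENNReal.ofReal (dyadicScale lam k ^ (homDim d - β * p)) *
    cellEnergy μ p (dyadicScale lam k)

/-- The dyadic Wolff inequality. -/
theorem exists_lintegral_tsum_blockTerm_le {α β p : ℝ} (hα : 0 < α) (hαβ : α + β = homDim d)
    (hp : 1 < p) : ∃ C : ℝ≥0∞, C ≠ ⊤ ∧ ∀ (μ : Measure (SpaceTime d)) [SFinite μ] (T : Set ℤ)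
      {lam : ℝ}, 0 < lam →
      ∫⁻ w, (∑' k : T, blockTerm μ β (dyadicScale lam k) w) ^ p ≤
        C * dyadicEnergy μ β p lam T := by
  set r := ENNReal.ofReal (2 ^ (-α)) with hr
  set N : ℝ≥0∞ := ((unitBlock d).card : ℝ≥0∞) with hN
  have hN0 : N ≠ 0 := by
    rw [hN, Nat.cast_ne_zero]; exact Finset.card_ne_zero_of_mem zero_mem_unitBlock
  have hNt : N ≠ ⊤ := by simp [hN]
  set C := N * (1 - r)⁻¹ with hC
  have hr1 : 1 - r ≠ 0 := (tsub_pos_of_lt (ofReal_two_rpow_neg_lt_one hα)).ne'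
  have hC0 : C ≠ 0 := mul_ne_zero hN0 (ENNReal.inv_ne_zero.2 (by simp))
  have hCt : C ≠ ⊤ := ENNReal.mul_ne_top hNt (ENNReal.inv_ne_top.2 hr1)
  refine ⟨(ENNReal.ofReal p * C + (ENNReal.ofReal (p * (p - 1)) * C) ^ p) * N ^ p, ?_, ?_⟩
  · have := ENNReal.mul_ne_top (ENNReal.ofReal_ne_top (r := p)) hCt
    have h2 := ENNReal.rpow_ne_top_of_nonneg (y := p) (by linarith)
      (ENNReal.mul_ne_top (ENNReal.ofReal_ne_top (r := p * (p - 1))) hCt)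
    exact ENNReal.mul_ne_top (ENNReal.add_ne_top.2 ⟨this, h2⟩)
      (ENNReal.rpow_ne_top_of_nonneg (by linarith) hNt)
  intro μ _ T lam hlam
  have hs : ∀ k, 0 < dyadicScale lam k := dyadicScale_pos hlam
  set a : T → SpaceTime d → ℝ≥0∞ := fun k => blockTerm μ β (dyadicScale lam k) with ha
  have ham : ∀ k, Measurable (a k) := fun k => measurable_blockTerm _ _ _
  have hfinite : ∀ I : Finset T, ∫⁻ w, (∑ k ∈ I, a k w) ^ p ≤
      (ENNReal.ofReal p * C + (ENNReal.ofReal (p * (p - 1)) * C) ^ p) *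
        ∑ k ∈ I, ∫⁻ w, a k w ^ p := by
    intro I
    refine lintegral_sum_rpow_le ham (π := fun k : T => cell (dyadicScale lam k))
      (fun k => blockTerm_factorsThrough _ _ _) ?_ hC0 ?_ hp
    · intro i j hij
      rw [dyadicScale_of_le lam (Subtype.coe_le_coe.2 hij)]
      exact cell_factorsThrough _ _
    · intro k _ F hF
      have hFm : Measurable F := by
        obtain ⟨G, rfl⟩ := (Function.factorsThrough_iff F).1 hF
        exact (measurable_of_countable G).comp (measurable_cell _)
      simp_rw [Finset.mul_sum]
      rw [lintegral_finsetSum (f := fun j w => F w * a j w) _ fun j _ => hFm.mul (ham j)]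
      calc ∑ j ∈ I with j ≤ k, ∫⁻ w, F w * a j w
          ≤ ∑ j ∈ I with j ≤ k, N * r ^ ((k : ℤ) - j).toNat * ∫⁻ w, F w * a k w := by
            refine Finset.sum_le_sum fun j hj => ?_
            have hjk : (j : ℤ) ≤ k := (Finset.mem_filter.1 hj).2
            simp only [ha]
            rw [dyadicScale_of_le lam hjk] at hF ⊢
            exact lintegral_mul_blockTerm_le μ (hs j) hαβ _ hF
        _ = N * (∑ j ∈ I with j ≤ k, r ^ ((k : ℤ) - j).toNat) * ∫⁻ w, F w * a k w := by
            rw [← Finset.sum_mul, ← Finset.mul_sum]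
        _ ≤ _ := by
            rw [hC]
            gcongr
            exact sum_geometric_le I k r
  have hsup : ∀ w, (∑' k : T, a k w) ^ p = ⨆ I : Finset T, (∑ k ∈ I, a k w) ^ p := by
    intro w
    rw [ENNReal.tsum_eq_iSup_sum]
    exact (ENNReal.orderIsoRpow p (by linarith)).map_iSup _
  calc ∫⁻ w, (∑' k : T, a k w) ^ p
      = ⨆ I : Finset T, ∫⁻ w, (∑ k ∈ I, a k w) ^ p := by
        simp_rw [hsup]
        refine lintegral_iSup_directed
          (fun I => ((Finset.measurable_fun_sum _ fun k _ => ham k).pow_const _).aemeasurable) ?_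
        refine directed_of_isDirected_le fun I J hIJ w => ?_
        exact ENNReal.rpow_le_rpow (Finset.sum_le_sum_of_subset hIJ) (by linarith)
    _ ≤ (ENNReal.ofReal p * C + (ENNReal.ofReal (p * (p - 1)) * C) ^ p) *
        ∑' k : T, ∫⁻ w, a k w ^ p := by
        refine iSup_le fun I => (hfinite I).trans ?_
        gcongr
        exact ENNReal.sum_le_tsum I
    _ ≤ _ := by
        rw [mul_assoc, dyadicEnergy, ← ENNReal.tsum_mul_left (a := N ^ p)]
        gcongr with k
        rw [lintegral_blockTerm_rpow (hs k) _ _ (by linarith), mul_left_comm]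
        gcongr
        exact tsum_blockMass_rpow_le μ _ hp

/-! ### Bounds for the kernels -/

lemma mem_cell_preimage {s : ℝ} (hs : 0 < s) {z w : SpaceTime d} {e : CellIndex d}
    (h : cell s z = cell s w + e) :
    (∀ i, s * (e.1 i - 1) < z.1 i - w.1 i ∧ z.1 i - w.1 i < s * (e.1 i + 1)) ∧
      s ^ 2 * (e.2 - 1) < z.2 - w.2 ∧ z.2 - w.2 < s ^ 2 * (e.2 + 1) := by
  have key : ∀ {r x y : ℝ} {n : ℤ}, 0 < r → ⌊x / r⌋ = ⌊y / r⌋ + n →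
      r * (n - 1) < x - y ∧ x - y < r * (n + 1) := by
    intro r x y n hr hxy
    have h1 := Int.floor_le (x / r)
    have h2 := Int.lt_floor_add_one (x / r)
    have h3 := Int.floor_le (y / r)
    have h4 := Int.lt_floor_add_one (y / r)
    have h5 : (⌊x / r⌋ : ℝ) = ⌊y / r⌋ + n := by exact_mod_cast hxy
    have h6 : x - y = r * (x / r - y / r) := by field_simp
    rw [h6]
    constructor <;> exact mul_lt_mul_of_pos_left (by linarith) hr
  simp only [cell, Prod.ext_iff, funext_iff, Prod.fst_add, Pi.add_apply, Prod.snd_add] at h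
  exact ⟨fun i => key hs (h.1 i), key (pow_pos hs 2) h.2⟩

lemma norm_sq_le_of_forall_abs_le {x : EuclideanSpace ℝ (Fin d)} {s : ℝ}
    (h : ∀ i, |x i| ≤ s) : ‖x‖ ^ 2 ≤ d * s ^ 2 := by
  rw [EuclideanSpace.real_norm_sq_eq]
  calc ∑ i, x i ^ 2 ≤ ∑ _i : Fin d, s ^ 2 :=
        Finset.sum_le_sum fun i _ => sq_le_sq.2 ((h i).trans (le_abs_self s))
    _ = d * s ^ 2 := by simp

lemma abs_apply_le_norm (x : EuclideanSpace ℝ (Fin d)) (i : Fin d) : |x i| ≤ ‖x‖ := by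
  simpa using PiLp.norm_apply_le x i

/-- The shift by two cells forward in time. -/
def timeShift (d : ℕ) : CellIndex d := (0, 2)

lemma four_mul_dyadicScale_sq_le {lam : ℝ} (hlam : 0 < lam) {j k : ℤ} (h : j < k) :
    4 * dyadicScale lam j ^ 2 ≤ dyadicScale lam k ^ 2 := by
  have h1 : dyadicScale lam (j + (1 : ℕ)) ≤ dyadicScale lam k := by
    unfold dyadicScale
    gcongr
    · norm_num
    · push_cast; omega
  rw [dyadicScale_add_nat] at h1
  have h0 := dyadicScale_pos hlam j
  nlinarith

lemma pairwise_disjoint_timeShift {lam : ℝ} (hlam : 0 < lam) (T : Set ℤ) (w : SpaceTime d) :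
    Pairwise (Function.onFun Disjoint fun k : T => cell (dyadicScale lam k) ⁻¹'
      {cell (dyadicScale lam k) w + timeShift d}) := by
  have hlt : ∀ j k : T, j < k → ∀ z, z ∈ cell (dyadicScale lam j) ⁻¹'
      {cell (dyadicScale lam j) w + timeShift d} → z ∉ cell (dyadicScale lam k) ⁻¹'
      {cell (dyadicScale lam k) w + timeShift d} := by
    intro j k hjk z hj hk
    have h1 := (mem_cell_preimage (dyadicScale_pos hlam j) hj).2.2
    have h2 := (mem_cell_preimage (dyadicScale_pos hlam k) hk).2.1
    have h3 := four_mul_dyadicScale_sq_le hlam (Subtype.coe_lt_coe.2 hjk)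
    have h4 := pow_pos (dyadicScale_pos hlam j) 2
    simp only [timeShift] at h1 h2
    push_cast at h1 h2
    linarith
  intro j k hjk
  rw [Function.onFun, Set.disjoint_left]
  intro z hj hk
  rcases lt_or_gt_of_ne hjk with h | h
  · exact hlt j k h z hj hk
  · exact hlt k j h z hk hj

/-- Only the size of the kernel on the time-shifted cells matters for the lower bound of the energy. -/
theorem dyadicEnergy_le_lintegral_backwardPotential (μ : Measure (SpaceTime d))
    {K : SpaceTime d → ℝ} {β p c lam : ℝ} (hp : 1 < p) (hlam : 0 < lam) {T : Set ℤ}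
    (hc : 0 ≤ c)
    (hK : ∀ k ∈ T, ∀ z : SpaceTime d, dyadicScale lam k ^ 2 < z.2 →
      z.2 < 3 * dyadicScale lam k ^ 2 → ‖z.1‖ ^ 2 ≤ d * dyadicScale lam k ^ 2 →
      c * dyadicScale lam k ^ (-β) ≤ K z) :
    ENNReal.ofReal c ^ p * dyadicEnergy μ β p lam T ≤
      ∫⁻ w, backwardPotential K μ w ^ p := by
  have hs := dyadicScale_pos hlam
  set s := dyadicScale lam with hsdef
  have hp0 : 0 ≤ p := by linarith
  have hpt : ∀ w, ∑' k : T, ENNReal.ofReal c * (ENNReal.ofReal (s k ^ (-β)) *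
      cellMass μ (s k) (cell (s k) w + timeShift d)) ≤ backwardPotential K μ w := by
    intro w
    calc _ ≤ ∑' k : T, ∫⁻ z in cell (s k) ⁻¹' {cell (s k) w + timeShift d},
            ENNReal.ofReal (K (z - w)) ∂μ := by
          refine ENNReal.tsum_le_tsum fun k => ?_
          rw [← mul_assoc, ← ENNReal.ofReal_mul hc, cellMass, ← setLIntegral_const]
          refine setLIntegral_mono' (measurable_cell _ (measurableSet_singleton _)) fun z hz => ?_
          refine ENNReal.ofReal_le_ofReal ?_
          have h := mem_cell_preimage (hs k) (mem_singleton_iff.1 hz)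
          simp only [timeShift, Pi.zero_apply] at h
          push_cast at h
          refine hK k k.2 _ ?_ ?_ ?_
          · simp only [Prod.snd_sub]; linarith [h.2.1]
          · simp only [Prod.snd_sub]; linarith [h.2.2]
          · refine norm_sq_le_of_forall_abs_le fun i => ?_
            have := h.1 i
            simp only [Prod.fst_sub, PiLp.sub_apply]
            rw [abs_le]; constructor <;> linarith [this.1, this.2]
      _ = ∫⁻ z in ⋃ k : T, cell (s k) ⁻¹' {cell (s k) w + timeShift d},
            ENNReal.ofReal (K (z - w)) ∂μ :=
          (lintegral_iUnion (fun k => measurable_cell _ (measurableSet_singleton _))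
            (pairwise_disjoint_timeShift hlam T w) _).symm
      _ ≤ _ := setLIntegral_le_lintegral _ _
  have hm : ∀ k : T, Measurable fun w : SpaceTime d => (ENNReal.ofReal c *
      (ENNReal.ofReal (s k ^ (-β)) * cellMass μ (s k) (cell (s k) w + timeShift d))) ^ p :=
    fun k => (measurable_of_countable fun e : CellIndex d => (ENNReal.ofReal c *
      (ENNReal.ofReal (s k ^ (-β)) * cellMass μ (s k) (e + timeShift d))) ^ p).comp
        (measurable_cell _)
  calc ENNReal.ofReal c ^ p * dyadicEnergy μ β p lam T
      = ∑' k : T, ∫⁻ w, (ENNReal.ofReal c * (ENNReal.ofReal (s k ^ (-β)) *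
          cellMass μ (s k) (cell (s k) w + timeShift d))) ^ p := by
        have he : ∀ k : T, ∑' e, cellMass μ (s k) (e + timeShift d) ^ p =
            ∑' e, cellMass μ (s k) e ^ p := fun k =>
          (Equiv.addRight (timeShift d)).tsum_eq fun e => cellMass μ (s k) e ^ p
        rw [dyadicEnergy, ← ENNReal.tsum_mul_left]
        refine tsum_congr fun k => ?_
        simp only [ENNReal.mul_rpow_of_nonneg _ _ hp0]
        rw [lintegral_comp_cell_volume (hs k) fun e => ENNReal.ofReal c ^ p *
          (ENNReal.ofReal (s k ^ (-β)) ^ p * cellMass μ (s k) (e + timeShift d) ^ p),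
          ENNReal.tsum_mul_left, ENNReal.tsum_mul_left,
          he k,
          ofReal_rpow_rpow (hs k), cellVolume, cellEnergy, ← hsdef,
          show homDim d - β * p = homDim d + -β * p by ring, ← ofReal_rpow_mul_ofReal_rpow (hs k)]
        ring
    _ = ∫⁻ w, ∑' k : T, (ENNReal.ofReal c * (ENNReal.ofReal (s k ^ (-β)) *
          cellMass μ (s k) (cell (s k) w + timeShift d))) ^ p :=
        (lintegral_tsum fun k => (hm k).aemeasurable).symm
    _ ≤ _ := lintegral_mono fun w => (tsum_rpow_le_rpow_tsum _ hp.le).trans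
        (ENNReal.rpow_le_rpow (hpt w) hp0)

/-- The normalizing constant of the parabolic Riesz and Bessel kernels. -/
noncomputable def kernelConst (d : ℕ) (α : ℝ) : ℝ :=
  ((4 * Real.pi) ^ ((d : ℝ) / 2) * Real.Gamma (α / 2))⁻¹

lemma kernelConst_pos (d : ℕ) {α : ℝ} (hα : 0 < α) : 0 < kernelConst d α := by
  have := Real.Gamma_pos_of_pos (half_pos hα)
  unfold kernelConst; positivity

lemma rpow_neg_ge_of_le_three_mul_sq {s t b : ℝ} (hb : 0 ≤ b) (ht : 0 < t) (hs : 0 < s)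
    (hts : t ≤ 3 * s ^ 2) : 3 ^ (-b) * s ^ (-(2 * b)) ≤ t ^ (-b) := by
  calc (3 : ℝ) ^ (-b) * s ^ (-(2 * b)) = (3 * s ^ 2) ^ (-b) := by
        rw [Real.mul_rpow (by norm_num) (by positivity), ← Real.rpow_natCast s 2,
          ← Real.rpow_mul hs.le]
        congr 2; push_cast; ring
    _ ≤ _ := Real.rpow_le_rpow_of_nonpos ht hts (by linarith)

lemma sq_div_le_of_le {R s t D : ℝ} (hD : 0 ≤ D) (ht : 0 < t) (hst : s ^ 2 < t)
    (hR : R ^ 2 ≤ D * s ^ 2) : R ^ 2 / (4 * t) ≤ D / 4 := by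
  rw [div_le_iff₀ (by positivity)]
  nlinarith

lemma rieszKernel_lower {α s : ℝ} (hα : 0 < α) (hαn : α ≤ homDim d) (hs : 0 < s)
    (z : SpaceTime d) (h1 : s ^ 2 < z.2) (h2 : z.2 < 3 * s ^ 2) (h3 : ‖z.1‖ ^ 2 ≤ d * s ^ 2) :
    kernelConst d α * 3 ^ (-(homDim d - α) / 2) * Real.exp (-(d / 4)) *
      s ^ (-(homDim d - α)) ≤ rieszKernel α z := by
  have ht : 0 < z.2 := (by positivity : 0 < s ^ 2).trans h1
  have e1 := rpow_neg_ge_of_le_three_mul_sq (b := (homDim d - α) / 2) (by linarith) ht hs h2.le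
  rw [show -(2 * ((homDim d - α) / 2)) = -(homDim d - α) by ring, ← neg_div] at e1
  have e2 := sq_div_le_of_le (Nat.cast_nonneg d) ht h1 h3
  have hc := kernelConst_pos d hα
  rw [rieszKernel, if_pos ht, ← kernelConst]
  calc _ = kernelConst d α * (3 ^ (-(homDim d - α) / 2) * s ^ (-(homDim d - α))) *
        Real.exp (-(d / 4)) := by ring
    _ ≤ _ := by
      gcongr
      rw [neg_div]; linarith

lemma besselKernel_lower {α s : ℝ} (hα : 0 < α) (hαn : α ≤ homDim d) (hs : 0 < s) (hs1 : s ≤ 1)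
    (z : SpaceTime d) (h1 : s ^ 2 < z.2) (h2 : z.2 < 3 * s ^ 2) (h3 : ‖z.1‖ ^ 2 ≤ d * s ^ 2) :
    kernelConst d α * 3 ^ (-(homDim d - α) / 2) * Real.exp (-(3 + d / 4)) *
      s ^ (-(homDim d - α)) ≤ besselKernel α z := by
  have ht : 0 < z.2 := (by positivity : 0 < s ^ 2).trans h1
  have e1 := rpow_neg_ge_of_le_three_mul_sq (b := (homDim d - α) / 2) (by linarith) ht hs h2.le
  rw [show -(2 * ((homDim d - α) / 2)) = -(homDim d - α) by ring, ← neg_div] at e1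
  have e2 := sq_div_le_of_le (Nat.cast_nonneg d) ht h1 h3
  have hc := kernelConst_pos d hα
  rw [besselKernel, if_pos ht, ← kernelConst]
  calc _ = kernelConst d α * (3 ^ (-(homDim d - α) / 2) * s ^ (-(homDim d - α))) *
        Real.exp (-(3 + d / 4)) := by ring
    _ ≤ _ := by
      gcongr
      nlinarith

/-- The Gaussian compensates the singularity at `t = 0` away from `x = 0`, so that the heat kernel is
bounded by a power of the parabolic distance `ρ`. -/
lemma rpow_neg_mul_exp_le {b R t ρ : ℝ} (hb : 0 < b) (ht : 0 < t)
    (hρ : ρ = max R (√t)) :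
    t ^ (-b) * Real.exp (-R ^ 2 / (8 * t)) ≤ (1 + (8 * b) ^ b) * ρ ^ (-(2 * b)) := by
  have hst : 0 < √t := Real.sqrt_pos.2 ht
  have hρ0 : 0 < ρ := hρ ▸ lt_max_of_lt_right hst
  have e1 : ρ ^ (-(2 * b)) = (ρ ^ 2) ^ (-b) := by
    rw [← Real.rpow_natCast ρ 2, ← Real.rpow_mul hρ0.le]; congr 1; push_cast; ring
  rw [e1]
  rcases le_total R (√t) with h | h
  · rw [max_eq_right h] at hρ
    rw [hρ, Real.sq_sqrt ht.le]
    have h1 : Real.exp (-R ^ 2 / (8 * t)) ≤ 1 := by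
      rw [Real.exp_le_one_iff]
      exact div_nonpos_of_nonpos_of_nonneg (by nlinarith) (by positivity)
    have h2 : 0 ≤ (8 * b) ^ b := by positivity
    have h3 : 0 < t ^ (-b) := by positivity
    nlinarith
  · rw [max_eq_left h] at hρ
    rw [hρ]
    have hR0 : 0 < R := hst.trans_le h
    have h1 : R ^ 2 / (8 * b * t) ≤ Real.exp (R ^ 2 / (8 * b * t)) := by
      linarith [Real.add_one_le_exp (R ^ 2 / (8 * b * t))]
    have h2 := Real.rpow_le_rpow (by positivity) h1 hb.le
    rw [← Real.exp_mul, Real.div_rpow (by positivity) (by positivity),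
      Real.mul_rpow (by positivity) ht.le, div_le_iff₀ (by positivity)] at h2
    rw [show R ^ 2 / (8 * b * t) * b = R ^ 2 / (8 * t) by field_simp] at h2
    rw [Real.rpow_neg ht.le, Real.rpow_neg (by positivity), neg_div, Real.exp_neg,
      ← mul_inv, ← div_eq_mul_inv, inv_le_comm₀ (by positivity) (by positivity), inv_div,
      div_le_iff₀ (by positivity)]
    have h3 : 0 < t ^ b * Real.exp (R ^ 2 / (8 * t)) := by positivity
    nlinarith

lemma cell_sub_mem_unitBlock {s : ℝ} (hs : 0 < s) {z w : SpaceTime d}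
    (h1 : ∀ i, |z.1 i - w.1 i| ≤ s) (h2 : |z.2 - w.2| ≤ s ^ 2) :
    cell s z - cell s w ∈ unitBlock d := by
  have key : ∀ {r x y : ℝ}, 0 < r → |x - y| ≤ r →
      -1 ≤ ⌊x / r⌋ - ⌊y / r⌋ ∧ ⌊x / r⌋ - ⌊y / r⌋ ≤ 1 := by
    intro r x y hr hxy
    rw [abs_le] at hxy
    have e1 : x / r ≤ y / r + 1 := by
      rw [← sub_le_iff_le_add', ← sub_div, div_le_one hr]; exact hxy.2
    have e2 : y / r ≤ x / r + 1 := by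
      rw [← sub_le_iff_le_add', ← sub_div, div_le_one hr]; linarith [hxy.1]
    have e3 := Int.floor_le_floor e1
    have e4 := Int.floor_le_floor e2
    rw [Int.floor_add_one] at e3 e4
    constructor <;> linarith
  rw [mem_unitBlock]
  exact ⟨fun i => key hs (h1 i), key (pow_pos hs 2) h2⟩

lemma exists_scale {lam ρ : ℝ} (hlam : 0 < lam) (hρ : 0 < ρ) :
    ∃ k : ℤ, dyadicScale lam (k - 1) < ρ ∧ ρ ≤ dyadicScale lam k := by
  obtain ⟨n, h1, h2⟩ := exists_mem_Ioc_zpow (div_pos hρ hlam) (one_lt_two (α := ℝ))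
  refine ⟨n + 1, ?_, ?_⟩
  · rw [add_sub_cancel_right, dyadicScale, mul_comm]
    exact (lt_div_iff₀ hlam).1 h1
  · rw [dyadicScale, mul_comm]
    exact (div_le_iff₀ hlam).1 h2

/-! ### Upper bounds for the potentials -/

/-- Upper bound for the energy of a kernel that is dominated by the sum of the indicators of the
blocks, weighted by `s ^ (-β)`, plus a summable function of the index difference at the scale
`lam`. -/
lemma lintegral_backwardPotential_le_of_kernel_le {α β p : ℝ} (hα : 0 < α)
    (hαβ : α + β = homDim d) (hp : 1 < p) {lam : ℝ} (hlam : 0 < lam) {T : Set ℤ} (hT : 0 ∈ T)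
    {K : SpaceTime d → ℝ} {A : ℝ≥0∞} (hA : A ≠ ⊤) {W : CellIndex d → ℝ≥0∞} (hW : ∑' e, W e ≠ ⊤)
    (hK : ∀ z w : SpaceTime d, ENNReal.ofReal (K (z - w)) ≤
      A * ∑' k : T, ENNReal.ofReal (dyadicScale lam k ^ (-β)) *
        {z | cell (dyadicScale lam k) z - cell (dyadicScale lam k) w ∈ unitBlock d}.indicator 1 z +
      W (cell lam z - cell lam w)) :
    ∃ C : ℝ≥0∞, C ≠ ⊤ ∧ ∀ (μ : Measure (SpaceTime d)) [SFinite μ],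
      ∫⁻ w, backwardPotential K μ w ^ p ≤ C * dyadicEnergy μ β p lam T := by
  have hp0 : 0 ≤ p := by linarith
  obtain ⟨C, hC, hCle⟩ := exists_lintegral_tsum_blockTerm_le hα hαβ hp
  set e₀ := ENNReal.ofReal (lam ^ (homDim d - β * p)) with he₀
  have he₀0 : e₀ ≠ 0 := by
    rw [he₀, Ne, ENNReal.ofReal_eq_zero, not_le]; positivity
  refine ⟨2 ^ (p - 1) * (A ^ p * C + cellVolume d lam * (∑' e, W e) ^ p * e₀⁻¹), ?_, ?_⟩
  · refine ENNReal.mul_ne_top (ENNReal.rpow_ne_top_of_nonneg (by linarith) (by simp))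
      (ENNReal.add_ne_top.2 ⟨ENNReal.mul_ne_top (ENNReal.rpow_ne_top_of_nonneg hp0 hA) hC,
        ENNReal.mul_ne_top (ENNReal.mul_ne_top ENNReal.ofReal_ne_top
          (ENNReal.rpow_ne_top_of_nonneg hp0 hW)) (ENNReal.inv_ne_top.2 he₀0)⟩)
  intro μ _
  have hmeas : ∀ (k : T) (w : SpaceTime d), MeasurableSet
      {z | cell (dyadicScale lam k) z - cell (dyadicScale lam k) w ∈ unitBlock d} := fun k w =>
    ((measurable_of_countable fun c : CellIndex d => c - cell (dyadicScale lam k) w).comp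
      (measurable_cell _)) (Finset.measurableSet (unitBlock d))
  have hpt : ∀ w, backwardPotential K μ w ≤
      A * ∑' k : T, blockTerm μ β (dyadicScale lam k) w +
        ∑' e, W e * cellMass μ lam (cell lam w + e) := by
    intro w
    refine (lintegral_mono fun z => hK z w).trans (le_of_eq ?_)
    have hm1 : ∀ k : T, Measurable fun z => ENNReal.ofReal (dyadicScale lam k ^ (-β)) *
        {z | cell (dyadicScale lam k) z - cell (dyadicScale lam k) w ∈ unitBlock d}.indicator
          (1 : SpaceTime d → ℝ≥0∞) z :=
      fun k => (measurable_one.indicator (hmeas k w)).const_mul _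
    rw [lintegral_add_left ((Measurable.tsum hm1).const_mul _),
      lintegral_const_mul _ (Measurable.tsum hm1),
      lintegral_tsum fun k => (hm1 k).aemeasurable,
      lintegral_comp_cell μ lam fun c => W (c - cell lam w)]
    congr 1
    · congr 1
      refine tsum_congr fun k => ?_
      rw [lintegral_const_mul _ (measurable_one.indicator (hmeas k w)),
        lintegral_indicator_one (hmeas k w)]
      rfl
    · rw [← (Equiv.addLeft (cell lam w)).tsum_eq]
      simp
  have hE : cellEnergy μ p lam ≤ e₀⁻¹ * dyadicEnergy μ β p lam T := by
    rw [← ENNReal.div_eq_inv_mul, ENNReal.le_div_iff_mul_le (Or.inl he₀0)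
      (Or.inl ENNReal.ofReal_ne_top), mul_comm]
    have := ENNReal.le_tsum (f := fun k : T => ENNReal.ofReal
      (dyadicScale lam k ^ (homDim d - β * p)) * cellEnergy μ p (dyadicScale lam k)) ⟨0, hT⟩
    simpa [dyadicScale, he₀, dyadicEnergy] using this
  have hmB : Measurable fun w => ∑' k : T, blockTerm μ β (dyadicScale lam k) w :=
    Measurable.tsum fun k => measurable_blockTerm _ _ _
  calc ∫⁻ w, backwardPotential K μ w ^ p
      ≤ ∫⁻ w, 2 ^ (p - 1) * (A ^ p * (∑' k : T, blockTerm μ β (dyadicScale lam k) w) ^ p +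
          (∑' e, W e * cellMass μ lam (cell lam w + e)) ^ p) := by
        refine lintegral_mono fun w => (ENNReal.rpow_le_rpow (hpt w) hp0).trans ?_
        refine (ENNReal.rpow_add_le_mul_rpow_add_rpow _ _ hp.le).trans_eq ?_
        rw [ENNReal.mul_rpow_of_nonneg _ _ hp0]
    _ = 2 ^ (p - 1) * (A ^ p * (∫⁻ w, (∑' k : T, blockTerm μ β (dyadicScale lam k) w) ^ p) +
          cellVolume d lam * ∑' c, (∑' e, W e * cellMass μ lam (c + e)) ^ p) := by
        rw [lintegral_const_mul' _ _
          (ENNReal.rpow_ne_top_of_nonneg (by linarith) (by simp)),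
          lintegral_add_left ((hmB.pow_const _).const_mul _),
          lintegral_const_mul _ (hmB.pow_const _), lintegral_comp_cell_volume hlam
            fun c => (∑' e, W e * cellMass μ lam (c + e)) ^ p]
    _ ≤ 2 ^ (p - 1) * (A ^ p * (C * dyadicEnergy μ β p lam T) +
          cellVolume d lam * ((∑' e, W e) ^ p * (e₀⁻¹ * dyadicEnergy μ β p lam T))) := by
        gcongr
        · exact hCle μ T hlam
        · exact (tsum_convolution_rpow_le _ _ hp).trans (by gcongr; exact hE)
    _ = _ := by ring

/-- The scale is the dyadic one just above the parabolic distance of `z` and `w`. -/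
lemma exists_scale_kernel_bound {b lam : ℝ} (hb : 0 < b) (hlam : 0 < lam) {z w : SpaceTime d}
    (h : 0 < z.2 - w.2) :
    ∃ k : ℤ, (max ‖z.1 - w.1‖ (√(z.2 - w.2)) ≤ lam → k ≤ 0) ∧
      cell (dyadicScale lam k) z - cell (dyadicScale lam k) w ∈ unitBlock d ∧
      (z.2 - w.2) ^ (-b) * Real.exp (-‖z.1 - w.1‖ ^ 2 / (8 * (z.2 - w.2))) ≤
        (1 + (8 * b) ^ b) * 2 ^ (2 * b) * dyadicScale lam k ^ (-(2 * b)) := by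
  set t := z.2 - w.2 with ht
  set R := ‖z.1 - w.1‖ with hR
  set ρ := max R (√t) with hρ
  have hρ0 : 0 < ρ := lt_max_of_lt_right (Real.sqrt_pos.2 h)
  obtain ⟨k, hk1, hk2⟩ := exists_scale hlam hρ0
  have hs := dyadicScale_pos hlam k
  have hs1 := dyadicScale_pos hlam (k - 1)
  refine ⟨k, fun hle => ?_, cell_sub_mem_unitBlock hs (fun i => ?_) ?_, ?_⟩
  · by_contra hk
    have h1 : lam * 2 ^ (0 : ℤ) ≤ dyadicScale lam (k - 1) := by
      unfold dyadicScale
      gcongr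
      · norm_num
      · omega
    rw [zpow_zero, mul_one] at h1
    linarith
  · have := abs_apply_le_norm (z.1 - w.1) i
    rw [PiLp.sub_apply] at this
    exact this.trans ((le_max_left _ _).trans hk2)
  · rw [← ht, abs_of_pos h, ← Real.sqrt_le_left hs.le]
    exact (le_max_right _ _).trans hk2
  · refine (rpow_neg_mul_exp_le hb h hρ).trans ?_
    rw [mul_assoc]
    gcongr
    have h2 : dyadicScale lam k = dyadicScale lam (k - 1) * 2 := by
      have := dyadicScale_add_nat lam (k - 1) 1
      simpa using this
    calc ρ ^ (-(2 * b)) ≤ dyadicScale lam (k - 1) ^ (-(2 * b)) :=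
          Real.rpow_le_rpow_of_nonpos hs1 hk1.le (by linarith)
      _ = _ := by
          rw [h2, Real.mul_rpow hs1.le (by norm_num), mul_left_comm, ← Real.rpow_add (by norm_num)]
          simp

lemma le_tsum_indicator {T : Set ℤ} {β lam : ℝ} {z w : SpaceTime d} {k : ℤ} (hk : k ∈ T)
    (h : cell (dyadicScale lam k) z - cell (dyadicScale lam k) w ∈ unitBlock d) :
    ENNReal.ofReal (dyadicScale lam k ^ (-β)) ≤
      ∑' k : T, ENNReal.ofReal (dyadicScale lam k ^ (-β)) *
        {z | cell (dyadicScale lam k) z - cell (dyadicScale lam k) w ∈ unitBlock d}.indicator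
          1 z := by
  refine le_trans ?_ (ENNReal.le_tsum ⟨k, hk⟩)
  rw [indicator_of_mem (by exact h)]
  simp

lemma rieszKernel_le {α : ℝ} (hα : 0 < α) {z : SpaceTime d} (hz : 0 < z.2) :
    rieszKernel α z ≤ kernelConst d α *
      (z.2 ^ (-((homDim d - α) / 2)) * Real.exp (-‖z.1‖ ^ 2 / (8 * z.2))) := by
  have hc := kernelConst_pos d hα
  rw [rieszKernel, if_pos hz, ← kernelConst, mul_assoc, neg_div (2 : ℝ)]
  gcongr _ * (_ * Real.exp ?_)
  rw [neg_div, neg_div, neg_le_neg_iff]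
  gcongr
  norm_num

lemma besselKernel_le_rieszKernel {α : ℝ} (hα : 0 < α) (z : SpaceTime d) :
    besselKernel α z ≤ rieszKernel α z := by
  unfold besselKernel rieszKernel
  have hc := kernelConst_pos d hα
  rw [kernelConst] at hc
  split_ifs with hz
  · gcongr
    rw [neg_div]; linarith
  · exact le_rfl

/-- A constant in the bound of the Riesz kernel by the dyadic powers `s ^ (-β)`. -/
noncomputable def kernelUpperConst (d : ℕ) (α : ℝ) : ℝ :=
  kernelConst d α * ((1 + (8 * ((homDim d - α) / 2)) ^ ((homDim d - α) / 2)) *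
    2 ^ (homDim d - α))

/-- The Riesz kernel is dominated by a sum over all dyadic scales; scales up to `lam` suffice for
pairs of points at parabolic distance at most `lam`. -/
lemma ofReal_rieszKernel_le {α lam : ℝ} (hα : 0 < α) (hαn : α < homDim d) (hlam : 0 < lam)
    {T : Set ℤ} {z w : SpaceTime d}
    (hT : T = univ ∨ max ‖z.1 - w.1‖ (√(z.2 - w.2)) ≤ lam ∧ T = Iic 0) :
    ENNReal.ofReal (rieszKernel α (z - w)) ≤
      ENNReal.ofReal (kernelUpperConst d α) *
      ∑' k : T, ENNReal.ofReal (dyadicScale lam k ^ (-(homDim d - α))) *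
        {z | cell (dyadicScale lam k) z - cell (dyadicScale lam k) w ∈ unitBlock d}.indicator
          1 z := by
  have hc := kernelConst_pos d hα
  by_cases hz : 0 < z.2 - w.2
  · obtain ⟨k, hk1, hk2, hk3⟩ := exists_scale_kernel_bound (b := (homDim d - α) / 2)
      (by linarith) hlam hz
    have hkT : k ∈ T := by
      rcases hT with rfl | ⟨h, rfl⟩
      · trivial
      · exact hk1 h
    have hb : 0 < (homDim d - α) / 2 := by linarith
    refine le_trans ?_ (mul_le_mul_right (le_tsum_indicator hkT hk2) _)
    rw [mul_div_cancel₀ _ (by norm_num : (2 : ℝ) ≠ 0)] at hk3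
    rw [kernelUpperConst, ← ENNReal.ofReal_mul (by positivity)]
    refine ENNReal.ofReal_le_ofReal ((rieszKernel_le hα (z := z - w) hz).trans ?_)
    rw [mul_assoc (kernelConst d α)]
    exact mul_le_mul_of_nonneg_left hk3 hc.le
  · have : rieszKernel α (z - w) = 0 := by
      rw [rieszKernel, if_neg (by simpa using hz)]
    simp [this]

theorem exists_lintegral_backwardPotential_rieszKernel_le {α p lam : ℝ} (hα : 0 < α)
    (hαn : α < homDim d) (hp : 1 < p) (hlam : 0 < lam) :
    ∃ C : ℝ≥0∞, C ≠ ⊤ ∧ ∀ (μ : Measure (SpaceTime d)) [SFinite μ],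
      ∫⁻ w, backwardPotential (rieszKernel α) μ w ^ p ≤
        C * dyadicEnergy μ (homDim d - α) p lam univ := by
  refine lintegral_backwardPotential_le_of_kernel_le hα (by ring) hp hlam (mem_univ _)
    (A := ENNReal.ofReal (kernelUpperConst d α)) ENNReal.ofReal_ne_top (W := 0) (by simp) fun z w => ?_
  exact (ofReal_rieszKernel_le hα hαn hlam (Or.inl rfl)).trans le_self_add

/-- A summable weight on cell indices, exponentially decaying in every coordinate. -/
noncomputable def expWeight (η : ℝ) (e : CellIndex d) : ℝ≥0∞ :=
  (∏ i, ENNReal.ofReal (Real.exp (-η * |(e.1 i : ℝ)|))) *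
    ENNReal.ofReal (Real.exp (-η * |(e.2 : ℝ)|))

lemma tsum_pi_prod_eq (n : ℕ) (g : ℤ → ℝ≥0∞) :
    ∑' f : Fin n → ℤ, ∏ i, g (f i) = (∑' a, g a) ^ n := by
  induction n with
  | zero => simp
  | succ n ih =>
    rw [← (Fin.consEquiv fun _ : Fin (n + 1) => ℤ).tsum_eq, ENNReal.tsum_prod']
    simp only [Fin.consEquiv, Equiv.coe_fn_mk, Fin.prod_univ_succ, Fin.cons_zero, Fin.cons_succ]
    simp_rw [ENNReal.tsum_mul_left, ih, ENNReal.tsum_mul_right, pow_succ, mul_comm]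

lemma tsum_int_exp_ne_top {η : ℝ} (hη : 0 < η) :
    ∑' a : ℤ, ENNReal.ofReal (Real.exp (-η * |(a : ℝ)|)) ≠ ⊤ := by
  refine Summable.tsum_ofReal_ne_top ?_
  have h : Summable fun n : ℕ => Real.exp (n * (-η)) :=
    Real.summable_exp_nat_mul_iff.2 (by linarith)
  refine Summable.of_nat_of_neg ?_ ?_
  · refine h.congr fun n => ?_
    simp [mul_comm]
  · refine h.congr fun n => ?_
    simp [mul_comm]

lemma tsum_expWeight_ne_top {η : ℝ} (hη : 0 < η) :
    ∑' e : CellIndex d, expWeight η e ≠ ⊤ := by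
  rw [ENNReal.tsum_prod']
  simp only [expWeight]
  simp_rw [ENNReal.tsum_mul_left, ENNReal.tsum_mul_right]
  rw [tsum_pi_prod_eq d fun a => ENNReal.ofReal (Real.exp (-η * |(a : ℝ)|))]
  exact ENNReal.mul_ne_top (ENNReal.pow_ne_top (tsum_int_exp_ne_top hη)) (tsum_int_exp_ne_top hη)

lemma expWeight_eq (η : ℝ) (e : CellIndex d) :
    expWeight η e = ENNReal.ofReal (Real.exp (-(η * (∑ i, |(e.1 i : ℝ)| + |(e.2 : ℝ)|)))) := by
  rw [expWeight, ← ENNReal.ofReal_prod_of_nonneg fun i _ => (Real.exp_pos _).le,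
    ← ENNReal.ofReal_mul (Finset.prod_nonneg fun i _ => (Real.exp_pos _).le), ← Real.exp_sum,
    ← Real.exp_add]
  congr 2
  rw [← Finset.mul_sum]; ring

lemma sum_abs_cell_sub_le {lam : ℝ} (hlam : 0 < lam) {z w : SpaceTime d} :
    ∑ i, |((cell lam z - cell lam w).1 i : ℝ)| + |((cell lam z - cell lam w).2 : ℝ)| ≤
      d * (‖z.1 - w.1‖ / lam + 1) + (|z.2 - w.2| / lam ^ 2 + 1) := by
  have key : ∀ {r x y : ℝ}, 0 < r → |((⌊x / r⌋ - ⌊y / r⌋ : ℤ) : ℝ)| ≤ |x - y| / r + 1 := by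
    intro r x y hr
    have h1 := Int.floor_le (x / r)
    have h2 := Int.lt_floor_add_one (x / r)
    have h3 := Int.floor_le (y / r)
    have h4 := Int.lt_floor_add_one (y / r)
    have h6 : |x - y| / r = |x / r - y / r| := by rw [← sub_div, abs_div, abs_of_pos hr]
    rw [h6, abs_le]
    push_cast
    constructor
    · linarith [neg_abs_le (x / r - y / r)]
    · linarith [le_abs_self (x / r - y / r)]
  refine add_le_add ?_ (key (pow_pos hlam 2))
  calc ∑ i, |((cell lam z - cell lam w).1 i : ℝ)|
      ≤ ∑ _i : Fin d, (‖z.1 - w.1‖ / lam + 1) := by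
        refine Finset.sum_le_sum fun i _ => (key hlam).trans ?_
        gcongr
        exact abs_apply_le_norm (z.1 - w.1) i
    _ = _ := by simp; ring

lemma half_add_le {t R : ℝ} (ht : 0 < t) : (t + R) / 2 ≤ t + R ^ 2 / (8 * t) := by
  have h : 0 ≤ (2 * t - R) ^ 2 / (8 * t) := by positivity
  have e : (2 * t - R) ^ 2 / (8 * t) = t / 2 - R / 2 + R ^ 2 / (8 * t) := by
    field_simp; ring
  linarith

/-- At parabolic distance at least `lam`, the Bessel kernel decays exponentially both in time and in
space: half of the Gaussian removes the singularity, the other half is used in `half_add_le`. -/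
lemma besselKernel_le_of_far {α lam : ℝ} (hα : 0 < α) (hαn : α < homDim d) (hlam : 0 < lam)
    {z : SpaceTime d} (hz : 0 < z.2) (hfar : lam ≤ max ‖z.1‖ (√z.2)) :
    besselKernel α z ≤ kernelConst d α *
      ((1 + (8 * ((homDim d - α) / 2)) ^ ((homDim d - α) / 2)) * lam ^ (-(homDim d - α))) *
        Real.exp (-((z.2 + ‖z.1‖) / 2)) := by
  have hc := kernelConst_pos d hα
  have hb : 0 < (homDim d - α) / 2 := by linarith
  have h1 := rpow_neg_mul_exp_le (R := ‖z.1‖) hb hz rfl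
  have h2 : max ‖z.1‖ (√z.2) ^ (-(2 * ((homDim d - α) / 2))) ≤ lam ^ (-(homDim d - α)) := by
    rw [mul_div_cancel₀ _ (by norm_num : (2 : ℝ) ≠ 0)]
    exact Real.rpow_le_rpow_of_nonpos hlam hfar (by linarith)
  have h3 : Real.exp (-z.2 - ‖z.1‖ ^ 2 / (4 * z.2)) ≤
      Real.exp (-‖z.1‖ ^ 2 / (8 * z.2)) * Real.exp (-((z.2 + ‖z.1‖) / 2)) := by
    rw [← Real.exp_add, Real.exp_le_exp]
    have := half_add_le (R := ‖z.1‖) hz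
    have e : ‖z.1‖ ^ 2 / (4 * z.2) = 2 * (‖z.1‖ ^ 2 / (8 * z.2)) := by field_simp; ring
    rw [neg_div, e]; linarith
  rw [besselKernel, if_pos hz, ← kernelConst, neg_div (2 : ℝ)]
  calc _ ≤ kernelConst d α * z.2 ^ (-((homDim d - α) / 2)) *
        (Real.exp (-‖z.1‖ ^ 2 / (8 * z.2)) * Real.exp (-((z.2 + ‖z.1‖) / 2))) := by gcongr
    _ = kernelConst d α * (z.2 ^ (-((homDim d - α) / 2)) *
        Real.exp (-‖z.1‖ ^ 2 / (8 * z.2))) * Real.exp (-((z.2 + ‖z.1‖) / 2)) := by ring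
    _ ≤ _ := by
      refine mul_le_mul_of_nonneg_right (mul_le_mul_of_nonneg_left (h1.trans ?_) hc.le)
        (Real.exp_pos _).le
      gcongr

theorem exists_lintegral_backwardPotential_besselKernel_le {α p lam : ℝ} (hα : 0 < α)
    (hαn : α < homDim d) (hp : 1 < p) (hlam : 0 < lam) :
    ∃ C : ℝ≥0∞, C ≠ ⊤ ∧ ∀ (μ : Measure (SpaceTime d)) [SFinite μ],
      ∫⁻ w, backwardPotential (besselKernel α) μ w ^ p ≤
        C * dyadicEnergy μ (homDim d - α) p lam (Iic 0) := by
  -- This rate is slow enough for the decay `exp (-(t + ‖x‖) / 2)` of the kernel to dominate the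
  -- weight, as index differences are at most the distances in units of the cell, plus one.
  set η := min (lam / (2 * (d + 1))) (lam ^ 2 / 2) with hη
  have hη0 : 0 < η := lt_min (by positivity) (by positivity)
  set B := kernelConst d α *
      ((1 + (8 * ((homDim d - α) / 2)) ^ ((homDim d - α) / 2)) * lam ^ (-(homDim d - α))) with hB
  have hc := kernelConst_pos d hα
  have hb : 0 < (homDim d - α) / 2 := by linarith
  have hB0 : 0 ≤ B := by positivity
  refine lintegral_backwardPotential_le_of_kernel_le hα (by ring) hp hlam
    (mem_Iic.2 le_rfl)
    (A := ENNReal.ofReal (kernelUpperConst d α)) ENNReal.ofReal_ne_top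
    (W := fun e => ENNReal.ofReal (B * Real.exp (η * (d + 1))) * expWeight η e) ?_
    fun z w => ?_
  · rw [ENNReal.tsum_mul_left]
    exact ENNReal.mul_ne_top ENNReal.ofReal_ne_top (tsum_expWeight_ne_top hη0)
  rcases le_total (max ‖z.1 - w.1‖ (√(z.2 - w.2))) lam with h | h
  · refine (ENNReal.ofReal_le_ofReal (besselKernel_le_rieszKernel hα _)).trans ?_
    exact (ofReal_rieszKernel_le hα hαn hlam (Or.inr ⟨h, rfl⟩)).trans le_self_add
  · by_cases hz : 0 < (z - w).2
    · refine le_trans ?_ le_add_self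
      rw [expWeight_eq, ← ENNReal.ofReal_mul (by positivity), mul_assoc, ← Real.exp_add]
      refine ENNReal.ofReal_le_ofReal ((besselKernel_le_of_far hα hαn hlam hz h).trans ?_)
      rw [← hB]
      gcongr
      have h1 := sum_abs_cell_sub_le hlam (z := z) (w := w)
      rw [abs_of_pos (show 0 < z.2 - w.2 from hz)] at h1
      generalize ∑ i, |((cell lam z - cell lam w).1 i : ℝ)| +
        |((cell lam z - cell lam w).2 : ℝ)| = S at h1 ⊢
      simp only [Prod.fst_sub, Prod.snd_sub] at hz ⊢
      set R := ‖z.1 - w.1‖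
      set t := z.2 - w.2
      have hR : 0 ≤ R := norm_nonneg _
      have hη1 : η * (d * (R / lam)) ≤ R / 2 := by
        calc η * (d * (R / lam)) ≤ lam / (2 * (d + 1)) * ((d + 1) * (R / lam)) := by
              gcongr
              · exact min_le_left _ _
              · linarith
          _ = R / 2 := by field_simp
      have hη2 : η * (t / lam ^ 2) ≤ t / 2 := by
        calc η * (t / lam ^ 2) ≤ lam ^ 2 / 2 * (t / lam ^ 2) := by
              gcongr
              exact min_le_right _ _
          _ = t / 2 := by field_simp
      have h2 := mul_le_mul_of_nonneg_left h1 hη0.le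
      have e : η * (d * (R / lam + 1) + (t / lam ^ 2 + 1)) =
          η * (d * (R / lam)) + η * (t / lam ^ 2) + η * (d + 1) := by ring
      linarith
    · rw [besselKernel, if_neg hz]
      simp

/-! ### Wolff potentials and the dyadic energy -/

/-- With respect to any real function, a definite part of a finite measure sees a definite part of the
measure below it: by symmetry the average of `ν {y | f y ≤ f x}` is at least `ν univ / 2`, hence
this quantity is at least `ν univ / 4` on a set of measure at least `ν univ / 4`. -/
lemma lintegral_measure_le_rpow_ge {X : Type*} [MeasurableSpace X] (ν : Measure X)
    [IsFiniteMeasure ν] {f : X → ℝ} (hf : Measurable f) {θ : ℝ} (hθ : 0 ≤ θ) :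
    (ν univ / 4) ^ (θ + 1) ≤ ∫⁻ x, ν {y | f y ≤ f x} ^ θ ∂ν := by
  have hS : MeasurableSet {x : X × X | f x.2 ≤ f x.1} :=
    measurableSet_le (hf.comp measurable_snd) (hf.comp measurable_fst)
  set S := {x : X × X | f x.2 ≤ f x.1} with hSdef
  have hS1 : Measurable (S.indicator (1 : X × X → ℝ≥0∞)) := measurable_one.indicator hS
  set G : X → ℝ≥0∞ := fun x => ν {y | f y ≤ f x} with hG
  have hGm : Measurable G := measurable_measure_prodMk_left hS
  set m := ν univ with hm
  have hGS : ∀ x, G x = ∫⁻ y, S.indicator 1 (x, y) ∂ν := fun x =>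
    (lintegral_indicator_one (measurable_prodMk_left hS)).symm
  have h1 : m * m ≤ 2 * ∫⁻ x, G x ∂ν := by
    calc m * m = ∫⁻ _x, ∫⁻ _y, 1 ∂ν ∂ν := by simp [hm]
      _ ≤ ∫⁻ x, ∫⁻ y, S.indicator 1 (x, y) + S.indicator 1 (y, x) ∂ν ∂ν := by
          refine lintegral_mono fun x => lintegral_mono fun y => ?_
          rcases le_total (f y) (f x) with h | h
          · have : (x, y) ∈ S := h
            simp [this]
          · have : (y, x) ∈ S := h
            simp [this]
      _ = ∫⁻ x, ∫⁻ y, S.indicator 1 (x, y) ∂ν ∂ν + ∫⁻ x, ∫⁻ y, S.indicator 1 (y, x) ∂ν ∂ν := by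
          rw [← lintegral_add_left hS1.lintegral_prod_right']
          refine lintegral_congr fun x => ?_
          exact lintegral_add_left (hS1.comp measurable_prodMk_left) _
      _ = 2 * ∫⁻ x, G x ∂ν := by
          rw [lintegral_lintegral_swap (f := fun x y => S.indicator 1 (y, x))
            (hS1.comp measurable_swap).aemeasurable, two_mul]
          simp_rw [hGS]
  set A := {x | m / 4 ≤ G x} with hA
  have hAm : MeasurableSet A := measurableSet_le measurable_const hGm
  have h2 : ∫⁻ x, G x ∂ν ≤ m * ν A + m / 4 * m := by
    rw [← lintegral_add_compl _ hAm]
    refine add_le_add ?_ ?_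
    · calc _ ≤ ∫⁻ _x in A, m ∂ν := lintegral_mono fun x => measure_mono (subset_univ _)
        _ = _ := by rw [setLIntegral_const]
    · calc _ ≤ ∫⁻ _x in Aᶜ, m / 4 ∂ν := setLIntegral_mono' hAm.compl fun x hx => by
            exact (not_le.1 (show ¬ m / 4 ≤ G x from hx)).le
        _ = m / 4 * ν Aᶜ := by rw [setLIntegral_const]
        _ ≤ _ := mul_le_mul_right (measure_mono (subset_univ _)) _
  have h3 : m / 4 ≤ ν A := by
    have hmt : m ≠ ⊤ := measure_ne_top _ _
    have hat : ν A ≠ ⊤ := measure_ne_top _ _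
    have h4 := h1.trans (mul_le_mul_right h2 2)
    generalize ν A = a at h4 hat ⊢
    clear_value m
    lift m to ℝ≥0 using hmt
    lift a to ℝ≥0 using hat
    rcases eq_or_ne m 0 with rfl | hm0
    · simp
    have e4 : (m : ℝ≥0∞) / 4 = ((m / 4 : ℝ≥0) : ℝ≥0∞) := by
      rw [ENNReal.coe_div (by norm_num)]; rfl
    rw [e4] at h4 ⊢
    have h5 : m * m ≤ 2 * (m * a + m / 4 * m) := by exact_mod_cast h4
    have hm0' : (0 : ℝ) < m := by positivity
    have h6 : (m : ℝ) * m ≤ 2 * (m * a + m / 4 * m) := by exact_mod_cast h5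
    have h7 : (m : ℝ) / 4 ≤ a := by
      by_contra! h
      nlinarith [mul_lt_mul_of_pos_left h hm0']
    exact_mod_cast h7
  calc (m / 4) ^ (θ + 1) = (m / 4) ^ θ * (m / 4) := by
        rw [ENNReal.rpow_add_of_nonneg _ _ hθ zero_le_one, ENNReal.rpow_one]
    _ ≤ (m / 4) ^ θ * ν A := by gcongr
    _ = ∫⁻ _x in A, (m / 4) ^ θ ∂ν := by rw [setLIntegral_const]
    _ ≤ ∫⁻ x in A, G x ^ θ ∂ν :=
        setLIntegral_mono' hAm fun x hx => ENNReal.rpow_le_rpow hx hθ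
    _ ≤ _ := setLIntegral_le_lintegral _ _

/-- The mass of the part of the cell of `z` that does not lie later than `z`. -/
noncomputable def pastCellMass (μ : Measure (SpaceTime d)) (s : ℝ) (z : SpaceTime d) : ℝ≥0∞ :=
  μ {y | cell s y = cell s z ∧ y.2 ≤ z.2}

lemma measurable_pastCellMass (μ : Measure (SpaceTime d)) [SFinite μ] (s : ℝ) :
    Measurable (pastCellMass μ s) := by
  have hS : MeasurableSet {x : SpaceTime d × SpaceTime d |
      cell s x.2 = cell s x.1 ∧ x.2.2 ≤ x.1.2} :=
    (measurableSet_eq_fun ((measurable_cell s).comp measurable_snd)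
      ((measurable_cell s).comp measurable_fst)).inter
      (measurableSet_le (measurable_snd.comp measurable_snd) (measurable_snd.comp measurable_fst))
  exact measurable_measure_prodMk_left hS

lemma dist_lt_of_cell_eq (hd : 2 ≤ d) {s r : ℝ} (hs : 0 < s) (hr : d * s ≤ r) {y z : SpaceTime d}
    (h : cell s y = cell s z) : dist y.1 z.1 < r ∧ |y.2 - z.2| < r ^ 2 := by
  have hd' : (2 : ℝ) ≤ d := by exact_mod_cast hd
  have h1 := mem_cell_preimage hs (z := y) (w := z) (e := 0) (by rw [h, add_zero])
  simp only [Prod.fst_zero, Pi.zero_apply, Prod.snd_zero] at h1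
  push_cast at h1
  have h2 : ‖y.1 - z.1‖ ^ 2 ≤ d * s ^ 2 := norm_sq_le_of_forall_abs_le fun i => by
    rw [PiLp.sub_apply, abs_le]; constructor <;> linarith [h1.1 i]
  have h3 : (d : ℝ) * s ^ 2 < r ^ 2 := by
    have : (d * s) ^ 2 ≤ r ^ 2 := by gcongr
    nlinarith [pow_pos hs 2]
  have hr0 : 0 < r := lt_of_lt_of_le (by positivity) hr
  constructor
  · rw [dist_eq_norm]
    exact lt_of_pow_lt_pow_left₀ 2 hr0.le (h2.trans_lt h3)
  · rw [abs_lt]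
    constructor <;> nlinarith [h1.2.1, h1.2.2, pow_pos hs 2]

lemma pastCellMass_le (hd : 2 ≤ d) (μ : Measure (SpaceTime d)) {s r : ℝ} (hs : 0 < s)
    (hr : d * s ≤ r) (z : SpaceTime d) : pastCellMass μ s z ≤ μ (backwardBall z r) := by
  refine measure_mono fun y hy => ?_
  obtain ⟨h1, h2⟩ := dist_lt_of_cell_eq hd hs hr hy.1
  rw [abs_lt] at h2
  exact ⟨h1, by linarith, hy.2⟩

lemma measure_backwardBall_le (μ : Measure (SpaceTime d)) {s r : ℝ} (hr : 0 < r) (hrs : r ≤ s)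
    (z : SpaceTime d) : μ (backwardBall z r) ≤ blockMass μ s (cell s z) := by
  refine measure_mono fun y hy => ?_
  have hs := hr.trans_le hrs
  obtain ⟨h1, h2, h3⟩ := hy
  refine cell_sub_mem_unitBlock hs (fun i => ?_) ?_
  · rw [Metric.mem_ball, dist_eq_norm] at h1
    exact (abs_apply_le_norm (y.1 - z.1) i).trans (h1.le.trans hrs)
  · have : r ^ 2 ≤ s ^ 2 := by gcongr
    rw [abs_le]; constructor <;> linarith

lemma cellMass_ne_top (hd : 2 ≤ d) (μ : Measure (SpaceTime d)) [IsLocallyFiniteMeasure μ] {s : ℝ}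
    (hs : 0 < s) (c : CellIndex d) : cellMass μ s c ≠ ⊤ := by
  refine (Bornology.IsBounded.measure_lt_top ?_).ne
  rw [Metric.isBounded_iff]
  refine ⟨max (d * s) ((d * s) ^ 2), fun y hy z hz => ?_⟩
  have h := dist_lt_of_cell_eq hd hs le_rfl (hy.trans hz.symm)
  rw [Prod.dist_eq, Real.dist_eq]
  exact max_le_max h.1.le h.2.le

lemma cellEnergy_le_lintegral_pastCellMass (hd : 2 ≤ d) (μ : Measure (SpaceTime d))
    [IsLocallyFiniteMeasure μ] {s p : ℝ} (hs : 0 < s) (hp : 1 < p) :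
    cellEnergy μ p s ≤ 4 ^ p * ∫⁻ z, pastCellMass μ s z ^ (p - 1) ∂μ := by
  have hU : ⋃ c : CellIndex d, cell s ⁻¹' {c} = (univ : Set (SpaceTime d)) := by
    ext z; simp
  have hcm : ∀ c : CellIndex d, MeasurableSet (cell s ⁻¹' {c} : Set (SpaceTime d)) := fun c =>
    measurable_cell s (measurableSet_singleton c)
  rw [← setLIntegral_univ, ← hU, lintegral_iUnion hcm, ← ENNReal.tsum_mul_left, cellEnergy]
  · refine ENNReal.tsum_le_tsum fun c => ?_
    set ν := μ.restrict (cell s ⁻¹' {c}) with hν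
    have hνu : ν univ = cellMass μ s c := by rw [hν, Measure.restrict_apply_univ, cellMass]
    have : IsFiniteMeasure ν := ⟨by rw [hνu]; exact (cellMass_ne_top hd μ hs c).lt_top⟩
    have h1 := lintegral_measure_le_rpow_ge ν (f := fun z : SpaceTime d => z.2) measurable_snd
      (θ := p - 1) (by linarith)
    rw [sub_add_cancel, hνu] at h1
    have h2 : ∫⁻ x, ν {y | y.2 ≤ x.2} ^ (p - 1) ∂ν ≤ ∫⁻ z, pastCellMass μ s z ^ (p - 1) ∂ν := by
      refine setLIntegral_mono' (hcm c) fun z hz => ?_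
      refine ENNReal.rpow_le_rpow ?_ (by linarith)
      rw [hν, Measure.restrict_apply (measurableSet_le measurable_snd measurable_const)]
      refine measure_mono fun y hy => ⟨?_, hy.1⟩
      exact (mem_singleton_iff.1 hy.2).trans (mem_singleton_iff.1 hz).symm
    calc cellMass μ s c ^ p = 4 ^ p * (cellMass μ s c / 4) ^ p := by
          rw [← ENNReal.mul_rpow_of_nonneg _ _ (by linarith),
            ENNReal.mul_div_cancel (by norm_num) (by norm_num)]
      _ ≤ _ := by gcongr; exact h1.trans h2
  · intro c c' hcc
    refine Disjoint.preimage _ ?_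
    simpa using hcc

/-- The power of the scale in the dyadic energy is the one in the Wolff potential. -/
lemma homDim_sub_mul_conjExp {α q : ℝ} (hq : 1 < q) :
    homDim d - (homDim d - α) * conjExp q = -((homDim d - α * q) * (conjExp q - 1)) := by
  have : q - 1 ≠ 0 := by linarith
  unfold conjExp
  field_simp
  ring

lemma one_lt_conjExp {q : ℝ} (hq : 1 < q) : 1 < conjExp q := by
  unfold conjExp
  rw [one_lt_div (by linarith)]; linarith

lemma div_ofReal_rpow_rpow (a : ℝ≥0∞) {x γ θ : ℝ} (hx : 0 < x) (hθ : 0 ≤ θ) :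
    (a / ENNReal.ofReal (x ^ γ)) ^ θ = ENNReal.ofReal (x ^ (-(γ * θ))) * a ^ θ := by
  rw [ENNReal.div_eq_inv_mul, ENNReal.mul_rpow_of_nonneg _ _ hθ,
    ← ENNReal.ofReal_inv_of_pos (by positivity), ← Real.rpow_neg hx.le, ofReal_rpow_rpow hx,
    neg_mul]

/-- Radii between `d * s` and `2 * d * s` capture the past part of a cell of scale `s`; the factor `d`
exceeds the diameter `√d` of the unit cube as `d ≥ 2`. -/
lemma le_setLIntegral_wolff (hd : 2 ≤ d) (μ : Measure (SpaceTime d)) {α q s : ℝ} (hq : 1 < q)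
    (hα : α * q ≤ homDim d) (hs : 0 < s) (z : SpaceTime d) :
    ENNReal.ofReal ((2 * d) ^ (homDim d - (homDim d - α) * conjExp q) / 2) *
      (ENNReal.ofReal (s ^ (homDim d - (homDim d - α) * conjExp q)) *
        pastCellMass μ s z ^ (conjExp q - 1)) ≤
    ∫⁻ r in Ioo (d * s) (2 * d * s),
      (μ (backwardBall z r) / ENNReal.ofReal (r ^ (homDim d - α * q))) ^ (conjExp q - 1) /
        ENNReal.ofReal r := by
  have hd0 : (0 : ℝ) < d := by exact_mod_cast (by omega : 0 < d)
  have hp := one_lt_conjExp hq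
  have hθ : 0 ≤ conjExp q - 1 := by linarith
  have hR : 0 < 2 * d * s := by positivity
  calc _ = ∫⁻ _r in Ioo (d * s) (2 * d * s), (pastCellMass μ s z /
        ENNReal.ofReal ((2 * d * s) ^ (homDim d - α * q))) ^ (conjExp q - 1) /
          ENNReal.ofReal (2 * d * s) := by
        rw [setLIntegral_const, Real.volume_Ioo, div_ofReal_rpow_rpow _ hR hθ,
          homDim_sub_mul_conjExp hq, Real.mul_rpow (by positivity) hs.le,
          ENNReal.div_eq_inv_mul, ← ENNReal.ofReal_inv_of_pos hR]
        generalize -((homDim d - α * q) * (conjExp q - 1)) = δ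
        generalize pastCellMass μ s z ^ (conjExp q - 1) = P
        rw [show ∀ a b c e : ℝ≥0∞, a * (b * c) * e = a * b * e * c by intros; ring, ← mul_assoc,
          ← ENNReal.ofReal_mul (by positivity), ← ENNReal.ofReal_mul (by positivity),
          ← ENNReal.ofReal_mul (by positivity)]
        congr 2
        field_simp
        ring
    _ ≤ _ := by
        refine setLIntegral_mono' measurableSet_Ioo fun r hr => ?_
        have hr0 : 0 < r := lt_trans (by positivity) hr.1
        gcongr
        · exact pastCellMass_le hd μ hs hr.1.le z
        · exact hr.2.le
        · exact hr.2.le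

theorem exists_dyadicEnergy_le_wolff (hd : 2 ≤ d) {α q lam : ℝ} (hq : 1 < q)
    (hα : α * q ≤ homDim d) (hlam : 0 < lam) {T : Set ℤ} {I : Set ℝ}
    (hTI : ∀ k ∈ T, Ioo (d * dyadicScale lam k) (2 * d * dyadicScale lam k) ⊆ I) :
    ∃ C : ℝ≥0∞, C ≠ ⊤ ∧ ∀ (μ : Measure (SpaceTime d)) [IsLocallyFiniteMeasure μ],
      dyadicEnergy μ (homDim d - α) (conjExp q) lam T ≤
        C * ∫⁻ z, wolffPotential backwardBall I α q μ z ∂μ := by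
  have hd0 : (0 : ℝ) < d := by exact_mod_cast (by omega : 0 < d)
  have hp := one_lt_conjExp hq
  have hs := dyadicScale_pos hlam
  set s := dyadicScale lam with hsdef
  set δ := homDim d - (homDim d - α) * conjExp q with hδ
  set p := conjExp q with hpdef
  set c := ENNReal.ofReal ((2 * d) ^ δ / 2) with hc
  have hc0 : c ≠ 0 := by
    rw [hc, Ne, ENNReal.ofReal_eq_zero, not_le]; positivity
  have hct : c ≠ ⊤ := ENNReal.ofReal_ne_top
  refine ⟨4 ^ p * c⁻¹, ENNReal.mul_ne_top (ENNReal.rpow_ne_top_of_nonneg (by linarith) (by simp))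
    (ENNReal.inv_ne_top.2 hc0), fun μ _ => ?_⟩
  -- The radii attached to different scales do not overlap, so the contributions add up.
  have hdisj : Pairwise (Function.onFun Disjoint fun k : T =>
      Ioo (d * s k) (2 * d * s k)) := by
    have hlt : ∀ j k : T, j < k → ∀ r, r ∈ Ioo (d * s j) (2 * d * s j) →
        r ∉ Ioo (d * s k) (2 * d * s k) := by
      intro j k hjk r hj hk
      have h1 := four_mul_dyadicScale_sq_le hlam (Subtype.coe_lt_coe.2 hjk)
      rw [← hsdef] at h1
      have h2 : 2 * s j ≤ s k := by
        have := hs j; have := hs k; nlinarith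
      nlinarith [hj.2, hk.1]
    intro j k hjk
    rw [Function.onFun, Set.disjoint_left]
    intro r hj hk
    rcases lt_or_gt_of_ne hjk with h | h
    · exact hlt j k h r hj hk
    · exact hlt k j h r hk hj
  have hpt : ∀ z, c * ∑' k : T, ENNReal.ofReal (s k ^ δ) * pastCellMass μ (s k) z ^ (p - 1) ≤
      wolffPotential backwardBall I α q μ z := by
    intro z
    rw [← ENNReal.tsum_mul_left]
    refine (ENNReal.tsum_le_tsum fun k : T => le_setLIntegral_wolff hd μ hq hα (hs k) z).trans ?_
    rw [← lintegral_iUnion (fun k => measurableSet_Ioo) hdisj]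
    exact lintegral_mono_set (iUnion_subset fun k => hTI k k.2)
  have hm : ∀ k : T, Measurable fun z => ENNReal.ofReal (s k ^ δ) *
      pastCellMass μ (s k) z ^ (p - 1) := fun k =>
    ((measurable_pastCellMass μ _).pow_const _).const_mul _
  calc dyadicEnergy μ (homDim d - α) p lam T
      ≤ ∑' k : T, ENNReal.ofReal (s k ^ δ) *
          (4 ^ p * ∫⁻ z, pastCellMass μ (s k) z ^ (p - 1) ∂μ) := by
        refine ENNReal.tsum_le_tsum fun k => ?_
        gcongr
        exact cellEnergy_le_lintegral_pastCellMass hd μ (hs k) hp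
    _ = 4 ^ p * ∫⁻ z, ∑' k : T, ENNReal.ofReal (s k ^ δ) *
          pastCellMass μ (s k) z ^ (p - 1) ∂μ := by
        rw [lintegral_tsum fun k => (hm k).aemeasurable, ← ENNReal.tsum_mul_left]
        refine tsum_congr fun k => ?_
        rw [lintegral_const_mul _ ((measurable_pastCellMass μ _).pow_const _)]
        ring
    _ ≤ 4 ^ p * ∫⁻ z, c⁻¹ * wolffPotential backwardBall I α q μ z ∂μ := by
        gcongr with z
        rw [← ENNReal.div_eq_inv_mul, ENNReal.le_div_iff_mul_le (Or.inl hc0) (Or.inl hct), mul_comm]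
        exact hpt z
    _ = _ := by
        rw [lintegral_const_mul' _ _ (ENNReal.inv_ne_top.2 hc0), mul_assoc]

lemma setLIntegral_wolff_le (μ : Measure (SpaceTime d)) {α q s : ℝ} (hq : 1 < q)
    (hα : α * q ≤ homDim d) (hs : 0 < s) (z : SpaceTime d) :
    ∫⁻ r in Ioc s (s * 2),
      (μ (backwardBall z r) / ENNReal.ofReal (r ^ (homDim d - α * q))) ^ (conjExp q - 1) /
        ENNReal.ofReal r ≤
    ENNReal.ofReal (2 ^ (-(homDim d - (homDim d - α) * conjExp q))) *
      (ENNReal.ofReal ((s * 2) ^ (homDim d - (homDim d - α) * conjExp q)) *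
        blockMass μ (s * 2) (cell (s * 2) z) ^ (conjExp q - 1)) := by
  have hθ : 0 ≤ conjExp q - 1 := by linarith [one_lt_conjExp hq]
  calc _ ≤ ∫⁻ _r in Ioc s (s * 2), (blockMass μ (s * 2) (cell (s * 2) z) /
        ENNReal.ofReal (s ^ (homDim d - α * q))) ^ (conjExp q - 1) / ENNReal.ofReal s := by
        refine setLIntegral_mono' measurableSet_Ioc fun r hr => ?_
        have hr0 : 0 < r := hs.trans hr.1
        gcongr
        · exact measure_backwardBall_le μ hr0 hr.2 z
        · exact hr.1.le
        · exact hr.1.le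
    _ = _ := by
        have e1 : ENNReal.ofReal (s * 2 - s) = ENNReal.ofReal s := by congr 1; ring
        rw [setLIntegral_const, Real.volume_Ioc, e1, ENNReal.div_mul_cancel
          (by simpa using hs) ENNReal.ofReal_ne_top, div_ofReal_rpow_rpow _ hs hθ, ← mul_assoc,
          ← ENNReal.ofReal_mul (by positivity), homDim_sub_mul_conjExp hq,
          Real.mul_rpow hs.le (by norm_num), mul_left_comm, ← Real.rpow_add (by norm_num),
          neg_add_cancel, Real.rpow_zero, mul_one]

theorem exists_wolff_le_dyadicEnergy {α q lam : ℝ} (hq : 1 < q)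
    (hα : α * q ≤ homDim d) (hlam : 0 < lam) {T : Set ℤ} {I : Set ℝ}
    (hTI : I ⊆ ⋃ k : T, Ioc (dyadicScale lam (k - 1)) (dyadicScale lam k)) :
    ∃ C : ℝ≥0∞, C ≠ ⊤ ∧ ∀ (μ : Measure (SpaceTime d)),
      ∫⁻ z, wolffPotential backwardBall I α q μ z ∂μ ≤
        C * dyadicEnergy μ (homDim d - α) (conjExp q) lam T := by
  have hp := one_lt_conjExp hq
  have hs := dyadicScale_pos hlam
  set s := dyadicScale lam with hsdef
  set δ := homDim d - (homDim d - α) * conjExp q with hδ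
  set p := conjExp q with hpdef
  set c := ENNReal.ofReal (2 ^ (-δ)) with hc
  refine ⟨c * ((unitBlock d).card : ℝ≥0∞) ^ p, ENNReal.mul_ne_top ENNReal.ofReal_ne_top
    (ENNReal.rpow_ne_top_of_nonneg (by linarith) (by simp)), fun μ => ?_⟩
  have hpt : ∀ z, wolffPotential backwardBall I α q μ z ≤
      ∑' k : T, c * (ENNReal.ofReal (s k ^ δ) * blockMass μ (s k) (cell (s k) z) ^ (p - 1)) := by
    intro z
    refine (lintegral_mono_set hTI).trans ((lintegral_iUnion_le _ _).trans
      (ENNReal.tsum_le_tsum fun k => ?_))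
    have h2 : s k = s (k - 1) * 2 := by
      have := dyadicScale_add_nat lam (k - 1) 1
      simpa using this
    rw [h2]
    exact setLIntegral_wolff_le μ hq hα (hs _) z
  have hm : ∀ k : T, Measurable fun z => c * (ENNReal.ofReal (s k ^ δ) *
      blockMass μ (s k) (cell (s k) z) ^ (p - 1)) := fun k =>
    (measurable_of_countable fun e : CellIndex d => c * (ENNReal.ofReal (s k ^ δ) *
      blockMass μ (s k) e ^ (p - 1))).comp (measurable_cell _)
  calc _ ≤ ∫⁻ z, ∑' k : T, c * (ENNReal.ofReal (s k ^ δ) *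
        blockMass μ (s k) (cell (s k) z) ^ (p - 1)) ∂μ := lintegral_mono hpt
    _ = ∑' k : T, c * (ENNReal.ofReal (s k ^ δ) *
        ∑' e, blockMass μ (s k) e ^ (p - 1) * cellMass μ (s k) e) := by
        rw [lintegral_tsum fun k => (hm k).aemeasurable]
        refine tsum_congr fun k => ?_
        rw [lintegral_comp_cell μ (s k) fun e => c * (ENNReal.ofReal (s k ^ δ) *
          blockMass μ (s k) e ^ (p - 1)), ← ENNReal.tsum_mul_left, ← ENNReal.tsum_mul_left]
        exact tsum_congr fun e => by ring
    _ ≤ ∑' k : T, c * (ENNReal.ofReal (s k ^ δ) *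
        (((unitBlock d).card : ℝ≥0∞) ^ p * cellEnergy μ p (s k))) := by
        gcongr with k
        refine le_trans (ENNReal.tsum_le_tsum fun e => ?_) (tsum_blockMass_rpow_le μ (s k) hp)
        calc _ ≤ blockMass μ (s k) e ^ (p - 1) * blockMass μ (s k) e ^ (1 : ℝ) := by
              rw [ENNReal.rpow_one]
              gcongr
              exact cellMass_le_blockMass μ (s k) e
          _ = _ := by rw [← ENNReal.rpow_add_of_nonneg _ _ (by linarith) zero_le_one, sub_add_cancel]
    _ = _ := by
        rw [dyadicEnergy, ← ENNReal.tsum_mul_left]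
        exact tsum_congr fun k => by ring

lemma wolffPotential_openBackwardBall {α q : ℝ} {I : Set ℝ} {μ : Measure (SpaceTime d)}
    (hμ : NoSliceMass μ) (z : SpaceTime d) :
    wolffPotential openBackwardBall I α q μ z = wolffPotential backwardBall I α q μ z := by
  have h : ∀ r, μ (openBackwardBall z r) = μ (backwardBall z r) := by
    intro r
    refine le_antisymm (measure_mono (prod_mono_right Ioo_subset_Ioc_self)) ?_
    calc μ (backwardBall z r) ≤ μ (openBackwardBall z r ∪ {y | y.2 = z.2}) := by
          refine measure_mono fun y hy => ?_
          rcases eq_or_lt_of_le hy.2.2 with h | h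
          · exact Or.inr h
          · exact Or.inl ⟨hy.1, hy.2.1, h⟩
      _ ≤ _ := measure_union_le _ _
      _ = _ := by rw [hμ, add_zero]
  simp only [wolffPotential, h]

/-! ### Comparison of the energies -/

/-- Assembly of the four comparisons with the dyadic energies. The energies `D` and `D'` may use
different ratios `lam`, as no comparison between them is needed. -/
lemma exists_comparableWith {α q : ℝ} {I : Set ℝ} {E D D' : Measure (SpaceTime d) → ℝ≥0∞}
    {c : ℝ≥0∞} (hc : c ≠ 0) (hc' : c ≠ ⊤)
    (h₁ : ∃ C : ℝ≥0∞, C ≠ ⊤ ∧ ∀ (μ : Measure (SpaceTime d)) [SFinite μ], E μ ≤ C * D μ)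
    (h₂ : ∃ C : ℝ≥0∞, C ≠ ⊤ ∧ ∀ (μ : Measure (SpaceTime d)) [IsLocallyFiniteMeasure μ],
      D μ ≤ C * ∫⁻ z, wolffPotential backwardBall I α q μ z ∂μ)
    (h₃ : ∃ C : ℝ≥0∞, C ≠ ⊤ ∧ ∀ (μ : Measure (SpaceTime d)),
      ∫⁻ z, wolffPotential backwardBall I α q μ z ∂μ ≤ C * D' μ)
    (h₄ : ∀ μ, c * D' μ ≤ E μ) :
    ∃ C : ℝ≥0, 0 < C ∧ ∀ (μ : Measure (SpaceTime d)) [IsLocallyFiniteMeasure μ],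
      ComparableWith C (E μ) (∫⁻ z, wolffPotential backwardBall I α q μ z ∂μ) ∧
      (NoSliceMass μ →
        ComparableWith C (E μ) (∫⁻ z, wolffPotential openBackwardBall I α q μ z ∂μ)) := by
  obtain ⟨C₁, hC₁, h₁⟩ := h₁
  obtain ⟨C₂, hC₂, h₂⟩ := h₂
  obtain ⟨C₃, hC₃, h₃⟩ := h₃
  have hct : C₁ * C₂ + C₃ * c⁻¹ + 1 ≠ ⊤ :=
    ENNReal.add_ne_top.2 ⟨ENNReal.add_ne_top.2 ⟨ENNReal.mul_ne_top hC₁ hC₂,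
      ENNReal.mul_ne_top hC₃ (ENNReal.inv_ne_top.2 hc)⟩, ENNReal.one_ne_top⟩
  refine ⟨(C₁ * C₂ + C₃ * c⁻¹ + 1).toNNReal, ENNReal.toNNReal_pos (by simp) hct, fun μ _ => ?_⟩
  have key : ComparableWith (C₁ * C₂ + C₃ * c⁻¹ + 1).toNNReal (E μ)
      (∫⁻ z, wolffPotential backwardBall I α q μ z ∂μ) := by
    rw [ComparableWith, ENNReal.coe_toNNReal hct]
    constructor
    · calc E μ ≤ C₁ * (C₂ * ∫⁻ z, wolffPotential backwardBall I α q μ z ∂μ) :=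
            (h₁ μ).trans (by gcongr; exact h₂ μ)
        _ = C₁ * C₂ * ∫⁻ z, wolffPotential backwardBall I α q μ z ∂μ := by rw [mul_assoc]
        _ ≤ _ := by
          gcongr
          rw [add_assoc]
          exact le_self_add
    · have h5 : D' μ ≤ c⁻¹ * E μ := by
        calc D' μ ≤ c⁻¹ * (c * D' μ) := by
              rw [← mul_assoc, ENNReal.inv_mul_cancel hc hc', one_mul]
          _ ≤ _ := by gcongr; exact h₄ μ
      calc _ ≤ C₃ * (c⁻¹ * E μ) := (h₃ μ).trans (by gcongr)
        _ = C₃ * c⁻¹ * E μ := by rw [mul_assoc]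
        _ ≤ _ := by
          gcongr
          exact le_add_self.trans le_self_add
  refine ⟨key, fun hμ => ?_⟩
  simp only [wolffPotential_openBackwardBall hμ]
  exact key

end ParabolicWolff

theorem theorem3p3 (d : ℕ) (hd : 2 ≤ d) (q : ℝ) (hq : 1 < q) (α : ℝ) (hα : 0 < α) :
    (α < ParabolicWolff.homDim d / q →
      ∃ C : ℝ≥0, 0 < C ∧
        ∀ (μ : Measure (ParabolicWolff.SpaceTime d)) [IsLocallyFiniteMeasure μ],
          ParabolicWolff.ComparableWith C (ParabolicWolff.rieszEnergy α q μ)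
            (ParabolicWolff.homWolffEnergy ParabolicWolff.backwardBall α q μ) ∧
          (ParabolicWolff.NoSliceMass μ →
            ParabolicWolff.ComparableWith C (ParabolicWolff.rieszEnergy α q μ)
              (ParabolicWolff.homWolffEnergy ParabolicWolff.openBackwardBall α q μ))) ∧
    (α ≤ ParabolicWolff.homDim d / q →
      ∃ C : ℝ≥0, 0 < C ∧
        ∀ (μ : Measure (ParabolicWolff.SpaceTime d)) [IsLocallyFiniteMeasure μ],
          ParabolicWolff.ComparableWith C (ParabolicWolff.besselEnergy α q μ)
            (ParabolicWolff.wolffEnergy ParabolicWolff.backwardBall α q μ) ∧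
          (ParabolicWolff.NoSliceMass μ →
            ParabolicWolff.ComparableWith C (ParabolicWolff.besselEnergy α q μ)
              (ParabolicWolff.wolffEnergy ParabolicWolff.openBackwardBall α q μ))) := by
  open ParabolicWolff in
  have hq0 : 0 < q := by linarith
  have hd0 : (0 : ℝ) < d := by exact_mod_cast (by omega : 0 < d)
  have hp := one_lt_conjExp hq
  have hc := kernelConst_pos d hα
  have hlt : α * q ≤ homDim d → α < homDim d := fun h => by nlinarith
  have hconst : ∀ e : ℝ, ENNReal.ofReal (kernelConst d α * 3 ^ (-(homDim d - α) / 2) *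
      Real.exp e) ^ conjExp q ≠ 0 := by
    intro e
    exact (ENNReal.rpow_pos (ENNReal.ofReal_pos.2 (by positivity)) ENNReal.ofReal_ne_top).ne'
  have hconst' : ∀ x : ℝ, ENNReal.ofReal x ^ conjExp q ≠ ⊤ := fun x =>
    ENNReal.rpow_ne_top_of_nonneg (by linarith) ENNReal.ofReal_ne_top
  constructor
  · intro hαq
    have h := ((lt_div_iff₀ hq0).1 hαq).le
    have hαn := hlt h
    refine exists_comparableWith (I := Ioi 0) (hconst (-(d / 4))) (hconst' _)
      (exists_lintegral_backwardPotential_rieszKernel_le hα hαn hp one_pos)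
      (exists_dyadicEnergy_le_wolff hd hq h one_pos fun k _ r hr => ?_)
      (exists_wolff_le_dyadicEnergy (T := univ) hq h one_pos fun r hr => ?_)
      fun μ => dyadicEnergy_le_lintegral_backwardPotential μ hp one_pos (by positivity)
        fun k _ z h1 h2 h3 => rieszKernel_lower hα hαn.le (dyadicScale_pos one_pos k) z h1 h2 h3
    · have := dyadicScale_pos one_pos k
      exact lt_trans (by positivity) hr.1
    · obtain ⟨k, hk⟩ := exists_scale one_pos hr
      exact mem_iUnion.2 ⟨⟨k, trivial⟩, hk⟩
  · intro hαq
    have h := (le_div_iff₀ hq0).1 hαq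
    have hαn := hlt h
    -- With this ratio, the radii `2 * d * s` that capture the coarsest cells do not exceed `1`.
    have hlam : (0 : ℝ) < 1 / (2 * d) := by positivity
    refine exists_comparableWith (I := Ioo 0 1) (hconst (-(3 + d / 4))) (hconst' _)
      (exists_lintegral_backwardPotential_besselKernel_le hα hαn hp hlam)
      (exists_dyadicEnergy_le_wolff hd hq h hlam fun k hk r hr => ?_)
      (exists_wolff_le_dyadicEnergy (T := Iic 0) hq h one_pos fun r hr => ?_)
      fun μ => dyadicEnergy_le_lintegral_backwardPotential μ hp one_pos (by positivity)
        fun k hk z h1 h2 h3 => besselKernel_lower hα hαn.le (dyadicScale_pos one_pos k) ?_ z h1 h2 h3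
    · have h0 := dyadicScale_pos hlam k
      refine ⟨lt_trans (by positivity) hr.1, hr.2.trans_le ?_⟩
      have h1 : (2 : ℝ) ^ k ≤ 1 := zpow_le_one_of_nonpos₀ (by norm_num) hk
      rw [dyadicScale]
      field_simp
      exact h1
    · obtain ⟨k, hk1, hk2⟩ := exists_scale one_pos hr.1
      refine mem_iUnion.2 ⟨⟨k, ?_⟩, hk1, hk2⟩
      by_contra hk
      have h1 : (1 : ℝ) ≤ 2 ^ (k - 1) := one_le_zpow₀ (by norm_num) (by simp at hk; omega)
      rw [dyadicScale, one_mul] at hk1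
      linarith [hr.2]
    · rw [dyadicScale, one_mul]
      exact zpow_le_one_of_nonpos₀ (by norm_num) hk
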